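/- Let $G\subset GL_d(\mathbb C)$ be a compact connected matrix Lie group, let $\mathcal M=M_d(\mathbb C)$ with the norm $\|A\|^2=\mathrm{tr}(AA^*)$, and let $S^1=\mathbb R/\mathbb Z$. For $s\in\mathbb R$ let $H^s(S^1,\mathcal M)$ be the completion of $C^\infty(S^1,\mathcal M)$ for the norm $\|f\|_s^2=\sum_{n\in\mathbb Z}(1+|n|)^{2s}\|f_n\|^2$, where $(f_n)$ are the Fourier coefficients of $f$, and let $H^s(S^1,G)$ be the closure of $C^\infty(S^1,G)$ in $H^s(S^1,\mathcal M)$. It carries the norm topology and the reflexive (Frölicher) completion of the trace diffeology: the trace diffeology consists of the $C^\infty$ maps from open subsets of $\mathbb R^m$, $m\in\mathbb N$, to $H^s(S^1,\mathcal M)$ with values in $H^s(S^1,G)$, and the plots of its completion are the maps along which all smooth real-valued functions are smooth. Let $H^{1/2,+}(S^1,G)=\bigcup_{s>1/2}H^s(S^1,G)$, with the inductive limit topology and diffeology (the finest for which all inclusions $H^s(S^1,G)\subset H^{1/2,+}(S^1,G)$, $s>1/2$, are continuous, respectively smooth). A map between such spaces is smooth if it maps plots to plots; products carry the product topology and the product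 diffeology. **Proposition.** 1. Let $k>1/2$. The elements of $H^k(S^1,G)$ are continuous loops in $G$, and $H^k(S^1,G)$ is a group under pointwise multiplication. For every real $s\le k$, the action of $C^\infty(S^1,G)$ on itself by pointwise left multiplication, $(\gamma,\eta)\mapsto\gamma\eta$, extends to a continuous and smooth action of this group $$H^k(S^1,G)\times H^s(S^1,G)\to H^s(S^1,G).$$ 2. The elements of $H^{1/2,+}(S^1,G)$ are continuous loops in $G$, and $H^{1/2,+}(S^1,G)$ is a group under pointwise multiplication. For every real $s\le 1/2$, the action of $C^\infty(S^1,G)$ on itself by pointwise left multiplication extends to a continuous and smooth action of this group $$H^{1/2,+}(S^1,G)\times H^s(S^1,G)\to H^s(S^1,G).$$ -/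

import Mathlib

open scoped ContDiff Matrix.Norms.Frobenius

noncomputable section

/-! ### Diffeologies: subsets of normed spaces, reflexive completion, products -/

namespace LoopDiffeology

open DiffeologicalSpace

/-- The trace on a subset `S` of a normed space `V` of the standard diffeology of `V`: the plots
are the smooth maps into `V` with values in `S`. -/
@[reducible]
def trace {V : Type*} [NormedAddCommGroup V] [NormedSpace ℝ V] (S : Set V) :
    DiffeologicalSpace S :=
  .ofCorePlotsOn {
    isPlotOn := fun {_ u} _ p => ContDiffOn ℝ ∞ (fun x => (p x : V)) u
    isPlotOn_congr := fun _ _ _ h => contDiffOn_congr fun x hx => by rw [h hx]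
    isPlot := fun p => ContDiff ℝ ∞ (fun x => (p x : V))
    isPlotOn_univ := contDiffOn_univ
    isPlot_const := fun _ => contDiff_const
    isPlotOn_reparam := fun _ _ _ h hp hf => hp.comp hf h
    locality := fun _ _ h x hxu => by
      obtain ⟨v, hv, hxv, hv'⟩ := h x hxu
      exact ((hv' x hxv).contDiffAt (hv.mem_nhds hxv)).contDiffWithinAt }

/-- A real valued function on a diffeological space is smooth if it is smooth along all plots. -/
def IsSmoothFunction {X : Type*} (D : DiffeologicalSpace X) (f : X → ℝ) : Prop :=
  ∀ (m : ℕ) (q : EuclideanSpace ℝ (Fin m) → X), q ∈ D.plots m → ContDiff ℝ ∞ (f ∘ q)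

/-- The reflexive (Frölicher) completion of a diffeology: its plots are the maps along which all
smooth real valued functions are smooth. -/
@[reducible]
def reflexiveCompletion {X : Type*} (D : DiffeologicalSpace X) : DiffeologicalSpace X :=
  .ofCorePlotsOn {
    isPlotOn := fun {_ u} _ p => ∀ f, IsSmoothFunction D f → ContDiffOn ℝ ∞ (f ∘ p) u
    isPlotOn_congr := fun _ _ _ h => forall₂_congr fun f _ =>
      contDiffOn_congr fun x hx => congrArg f (h hx)
    isPlot := fun p => ∀ f, IsSmoothFunction D f → ContDiff ℝ ∞ (f ∘ p)
    isPlotOn_univ := forall₂_congr fun _ _ => contDiffOn_univ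
    isPlot_const := fun _ _ _ => contDiff_const
    isPlotOn_reparam := fun _ _ _ h hp hf φ hφ => (hp φ hφ).comp hf h
    locality := fun _ _ h f hf x hxu => by
      obtain ⟨v, hv, hxv, hv'⟩ := h x hxu
      exact ((hv' f hf x hxv).contDiffAt (hv.mem_nhds hxv)).contDiffWithinAt }

/-- The product diffeology: plots are the pairs of plots. -/
instance prod {X Y : Type*} [DX : DiffeologicalSpace X] [DY : DiffeologicalSpace Y] :
    DiffeologicalSpace (X × Y) where
  plots n := {p | (fun x => (p x).1) ∈ DX.plots n ∧ (fun x => (p x).2) ∈ DY.plots n}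
  constant_plots z := ⟨DX.constant_plots z.1, DY.constant_plots z.2⟩
  plot_reparam hp hf := ⟨DX.plot_reparam hp.1 hf, DY.plot_reparam hp.2 hf⟩
  locality h :=
    ⟨DX.locality fun x => by
      obtain ⟨u, hu, hxu, h'⟩ := h x
      exact ⟨u, hu, hxu, fun hfu hf => (h' hfu hf).1⟩,
    DY.locality fun x => by
      obtain ⟨u, hu, hxu, h'⟩ := h x
      exact ⟨u, hu, hxu, fun hfu hf => (h' hfu hf).2⟩⟩

end LoopDiffeology

/-! ### The Sobolev spaces `H^s(S^1, V)`, `s ∈ ℝ` -/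

/-- The weight `(1 + |n|)^s`. -/
def sobolevWeight (s : ℝ) (n : ℤ) : ℝ := (1 + |(n : ℝ)|) ^ s

lemma sobolevWeight_pos (s : ℝ) (n : ℤ) : 0 < sobolevWeight s n := by
  unfold sobolevWeight; positivity

section Sobolev

variable (V : Type*) [NormedAddCommGroup V] [NormedSpace ℂ V]

/-- The families of Fourier coefficients `(c_n)` in `V` with `∑ (1 + |n|)^(2s) ‖c_n‖^2 < ∞`. -/
def sobolevSubmodule (s : ℝ) : Submodule ℂ (ℤ → V) where
  carrier := {c | Memℓp (fun n => (sobolevWeight s n : ℂ) • c n) 2}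
  add_mem' {a b} ha hb := by
    have := Memℓp.add ha hb
    simpa [Pi.add_def, smul_add] using this
  zero_mem' := by
    have : Memℓp (0 : ∀ _ : ℤ, V) 2 := zero_memℓp
    simpa [Pi.zero_def] using this
  smul_mem' z a ha := by
    have := Memℓp.const_smul (𝕜 := ℂ) ha z
    simpa [Pi.smul_def, smul_comm z] using this

/-- The Sobolev space `H^s(S^1, V)` of `V`-valued (generalized) functions on `S^1 = ℝ/ℤ`, each
identified with its family of Fourier coefficients. -/
def Sobolev (s : ℝ) : Type _ := sobolevSubmodule V s

namespace Sobolev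

variable {V} {s : ℝ}

instance : AddCommGroup (Sobolev V s) := inferInstanceAs (AddCommGroup (sobolevSubmodule V s))

instance : Module ℂ (Sobolev V s) := inferInstanceAs (Module ℂ (sobolevSubmodule V s))

/-- The Fourier coefficients of an element of `H^s(S^1, V)`. -/
def coeff (u : Sobolev V s) (n : ℤ) : V := u.1 n

variable (V s) in
/-- Multiplication of the `n`-th coefficient by `(1 + |n|)^s`, which carries `H^s` into `ℓ²`. -/
def toLp : Sobolev V s →ₗ[ℂ] lp (fun _ : ℤ => V) 2 where
  toFun u := ⟨fun n => (sobolevWeight s n : ℂ) • u.coeff n, u.2⟩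
  map_add' _ _ := by ext n; exact smul_add _ _ _
  map_smul' z _ := by ext n; exact smul_comm _ z _

lemma toLp_injective : Function.Injective (toLp V s) := by
  intro u v h
  refine Subtype.ext (funext fun n => ?_)
  have h' : (sobolevWeight s n : ℂ) • u.coeff n = (sobolevWeight s n : ℂ) • v.coeff n :=
    congrFun (congrArg Subtype.val h) n
  exact smul_right_injective V
    (Complex.ofReal_ne_zero.mpr (sobolevWeight_pos s n).ne') h'

/-- The norm of `H^s`, namely `‖u‖² = ∑ (1 + |n|)^(2s) ‖u_n‖²` (see `Sobolev.norm_sq_eq`). -/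
instance : NormedAddCommGroup (Sobolev V s) :=
  NormedAddCommGroup.induced (Sobolev V s) (lp (fun _ : ℤ => V) 2) (toLp V s) toLp_injective

instance : NormedSpace ℂ (Sobolev V s) :=
  NormedSpace.induced ℂ (Sobolev V s) (lp (fun _ : ℤ => V) 2) (toLp V s)

lemma norm_sq_eq (u : Sobolev V s) :
    ‖u‖ ^ 2 = ∑' n : ℤ, (1 + |(n : ℝ)|) ^ (2 * s) * ‖u.coeff n‖ ^ 2 := by
  have h : ‖u‖ = ‖toLp V s u‖ := rfl
  have h2 := lp.norm_rpow_eq_tsum (p := 2) (by norm_num) (toLp V s u)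
  norm_num at h2
  rw [h, h2]
  refine tsum_congr fun n => ?_
  have : ‖(toLp V s u) n‖ = sobolevWeight s n * ‖u.coeff n‖ := by
    change ‖(sobolevWeight s n : ℂ) • u.coeff n‖ = _
    rw [norm_smul, Complex.norm_real, Real.norm_of_nonneg (sobolevWeight_pos s n).le]
  rw [this, mul_pow, sobolevWeight, ← Real.rpow_natCast, ← Real.rpow_mul (by positivity)]
  norm_num [mul_comm]

end Sobolev

end Sobolev

/-! ### Smooth loops have rapidly decreasing Fourier coefficients -/

section Decay

variable {V : Type*} [NormedAddCommGroup V] [NormedSpace ℂ V]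

lemma norm_pow_mul_fourierIntegral_le [CompleteSpace V] (N : ℕ) : ∀ g : ℝ → V,
    ContDiff ℝ ∞ g → Function.Periodic g 1 →
    ∃ C : ℝ, ∀ n : ℤ, |(n : ℝ)| ^ N *
      ‖∫ x in (0 : ℝ)..1, fourier (-n) (x : UnitAddCircle) • g x‖ ≤ C := by
  induction N with
  | zero =>
    intro g hg _
    obtain ⟨C, hC⟩ := isCompact_Icc.exists_bound_of_continuousOn
      (s := Set.Icc (0 : ℝ) 1) hg.continuous.continuousOn
    refine ⟨C, fun n => ?_⟩
    rw [pow_zero, one_mul]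
    have := intervalIntegral.norm_integral_le_of_norm_le_const (a := 0) (b := 1) (C := C)
      (f := fun x : ℝ => fourier (-n) (x : UnitAddCircle) • g x) (fun x hx => by
        rw [Set.uIoc_of_le zero_le_one] at hx
        rw [norm_smul, fourier_apply, Circle.norm_coe, one_mul]
        exact hC x ⟨hx.1.le, hx.2⟩)
    simpa using this
  | succ N ih =>
    intro g hg hper
    have hg' : ContDiff ℝ ∞ (deriv g) := (contDiff_infty_iff_deriv.mp hg).2
    have hdiff : ∀ x, HasDerivAt g (deriv g x) x := fun x =>
      ((contDiff_infty_iff_deriv.mp hg).1 x).hasDerivAt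
    have hper' : Function.Periodic (deriv g) 1 := by
      intro x
      rw [← deriv_comp_add_const]
      congr 1
      exact funext hper
    obtain ⟨C, hC⟩ := ih (deriv g) hg' hper'
    refine ⟨C, fun n => le_trans ?_ (hC n)⟩
    rw [pow_succ, mul_assoc]
    refine mul_le_mul_of_nonneg_left ?_ (by positivity)
    have hcont : Continuous fun x : ℝ => fourier (-n) (x : UnitAddCircle) :=
      (map_continuous _).comp (AddCircle.continuous_mk' 1)
    have key := intervalIntegral.integral_smul_deriv_eq_deriv_smul_of_hasDerivAt
      (a := 0) (b := 1) (u := fun x : ℝ => fourier (-n) (x : UnitAddCircle)) (v := g)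
      (u' := fun x : ℝ => -2 * Real.pi * Complex.I * n / (1 : ℝ) *
        fourier (-n) (x : UnitAddCircle)) (v' := deriv g)
      hcont.continuousOn hg.continuous.continuousOn
      (fun x _ => hasDerivAt_fourier_neg 1 n x) (fun x _ => hdiff x)
      ((continuous_const.mul hcont).intervalIntegrable _ _)
      (hg'.continuous.intervalIntegrable _ _)
    have e1 : ((1 : ℝ) : UnitAddCircle) = ((0 : ℝ) : UnitAddCircle) := by simp
    have e2 : g 1 = g 0 := by simpa using hper 0
    rw [e1, e2, sub_self, zero_sub] at key
    simp_rw [mul_smul _ (fourier (-n) _)] at key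
    rw [intervalIntegral.integral_smul] at key
    rw [key, norm_neg, norm_smul]
    refine mul_le_mul_of_nonneg_right ?_ (norm_nonneg _)
    have : (1 : ℝ) ≤ 2 * Real.pi := by nlinarith [Real.pi_gt_three]
    simp only [norm_mul, norm_div, norm_neg, Complex.norm_real, Complex.norm_I, Complex.norm_intCast]
    norm_num
    rw [abs_of_pos Real.pi_pos]
    nlinarith [abs_nonneg (n : ℝ)]

lemma fourierCoeff_mem_sobolevSubmodule [CompleteSpace V] (s : ℝ) (γ : UnitAddCircle → V)
    (hγ : ContDiff ℝ ∞ fun x : ℝ => γ x) : fourierCoeff γ ∈ sobolevSubmodule V s := by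
  have hper : Function.Periodic (fun x : ℝ => γ x) 1 := fun x => by
    simp
  have hI : ∀ n, fourierCoeff γ n = ∫ x in (0 : ℝ)..1, fourier (-n) (x : UnitAddCircle) • γ x :=
    fun n => by simpa using fourierCoeff_eq_intervalIntegral γ n 0
  obtain ⟨N, hN⟩ := exists_nat_gt (s + 1)
  obtain ⟨C₀, h₀⟩ := norm_pow_mul_fourierIntegral_le 0 _ hγ hper
  obtain ⟨C₁, h₁⟩ := norm_pow_mul_fourierIntegral_le N _ hγ hper
  simp only [← hI] at h₀ h₁
  have hbd : ∀ n : ℤ, (1 + |(n : ℝ)|) ^ N * ‖fourierCoeff γ n‖ ≤ 2 ^ N * (C₀ + C₁) := by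
    intro n
    have h1 : (1 + |(n : ℝ)|) ^ N ≤ 2 ^ N * (|(n : ℝ)| ^ 0 + |(n : ℝ)| ^ N) := by
      have hle : (1 + |(n : ℝ)|) ^ N ≤ (2 * max 1 |(n : ℝ)|) ^ N := by
        gcongr
        have := le_max_left 1 |(n : ℝ)|
        have := le_max_right 1 |(n : ℝ)|
        linarith
      refine hle.trans ?_
      rw [mul_pow]
      gcongr
      rcases max_cases 1 |(n : ℝ)| with h | h <;> rw [h.1]
      · simp
      · simp
    calc _ ≤ 2 ^ N * (|(n : ℝ)| ^ 0 + |(n : ℝ)| ^ N) * ‖fourierCoeff γ n‖ := by gcongr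
      _ = 2 ^ N * (|(n : ℝ)| ^ 0 * ‖fourierCoeff γ n‖ + |(n : ℝ)| ^ N * ‖fourierCoeff γ n‖) := by
        ring
      _ ≤ _ := by gcongr; exacts [h₀ n, h₁ n]
  change Memℓp _ 2
  refine memℓp_gen ?_
  norm_num
  have hsum : Summable fun n : ℤ => (2 ^ N * (C₀ + C₁)) ^ 2 * (1 + |(n : ℝ)|) ^ (-2 : ℝ) := by
    refine Summable.mul_left _ ?_
    have h2 : Summable fun n : ℤ => |(n : ℝ)| ^ (-2 : ℝ) :=
      Real.summable_abs_int_rpow (by norm_num)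
    refine Summable.of_norm_bounded_eventually h2 ?_
    filter_upwards [(Set.finite_singleton (0 : ℤ)).compl_mem_cofinite] with n hn
    have hn' : (0 : ℝ) < |(n : ℝ)| := abs_pos.mpr (by exact_mod_cast hn)
    rw [Real.norm_of_nonneg (by positivity)]
    exact Real.rpow_le_rpow_of_nonpos hn' (by linarith) (by norm_num)
  refine Summable.of_nonneg_of_le (fun n => by positivity) (fun n => ?_) hsum
  have hw : 0 < sobolevWeight s n := sobolevWeight_pos s n
  have hx : (0 : ℝ) < 1 + |(n : ℝ)| := by positivity
  have hle : sobolevWeight s n * ‖fourierCoeff γ n‖ ≤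
      2 ^ N * (C₀ + C₁) * (1 + |(n : ℝ)|) ^ (-1 : ℝ) := by
    have h1 : sobolevWeight s n ≤ (1 + |(n : ℝ)|) ^ N * (1 + |(n : ℝ)|) ^ (-1 : ℝ) := by
      rw [sobolevWeight, ← Real.rpow_natCast, ← Real.rpow_add hx]
      exact Real.rpow_le_rpow_of_exponent_le (by linarith [abs_nonneg (n : ℝ)]) (by linarith)
    calc _ ≤ (1 + |(n : ℝ)|) ^ N * (1 + |(n : ℝ)|) ^ (-1 : ℝ) * ‖fourierCoeff γ n‖ := by gcongr
      _ = (1 + |(n : ℝ)|) ^ N * ‖fourierCoeff γ n‖ * (1 + |(n : ℝ)|) ^ (-1 : ℝ) := by ring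
      _ ≤ _ := mul_le_mul_of_nonneg_right (hbd n) (by positivity)
  rw [norm_smul, Real.norm_of_nonneg hw.le]
  calc _ ≤ (2 ^ N * (C₀ + C₁) * (1 + |(n : ℝ)|) ^ (-1 : ℝ)) ^ 2 := by gcongr
    _ = _ := by
      rw [mul_pow, ← Real.rpow_natCast ((1 + |(n : ℝ)|) ^ (-1 : ℝ)), ← Real.rpow_mul hx.le]
      norm_num

end Decay

/-! ### Loop spaces with values in a matrix group `G` -/

section Loops

variable {d : ℕ} (G : Subgroup (GL (Fin d) ℂ))

/-- The matrix valued loop underlying a loop in `G`. -/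
def loopMatrix {G : Subgroup (GL (Fin d) ℂ)} (γ : UnitAddCircle → G) (t : UnitAddCircle) :
    Matrix (Fin d) (Fin d) ℂ :=
  ((γ t : GL (Fin d) ℂ) : Matrix (Fin d) (Fin d) ℂ)

/-- The group `C^∞(S^1, G)` of smooth loops in `G`, with pointwise multiplication. -/
def SmoothLoops : Subgroup (UnitAddCircle → G) where
  carrier := {γ | ContDiff ℝ ∞ fun x : ℝ => loopMatrix γ x}
  mul_mem' {γ η} hγ hη := by
    have h₁ : ContDiff ℝ ∞ fun x : ℝ => loopMatrix γ x := hγ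
    have h₂ : ContDiff ℝ ∞ fun x : ℝ => loopMatrix η x := hη
    exact h₁.mul h₂
  one_mem' := by
    change ContDiff ℝ ∞ fun _ : ℝ => (1 : Matrix (Fin d) (Fin d) ℂ)
    exact contDiff_const
  inv_mem' {γ} hγ := by
    have h : ContDiff ℝ ∞ fun x : ℝ => loopMatrix γ x := hγ
    have : (fun x : ℝ => loopMatrix γ⁻¹ x) = fun x : ℝ => Ring.inverse (loopMatrix γ x) :=
      funext fun x => (Ring.inverse_unit (γ x : GL (Fin d) ℂ)).symm
    change ContDiff ℝ ∞ fun x : ℝ => loopMatrix γ⁻¹ x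
    rw [this, contDiff_iff_contDiffAt]
    intro x
    have h₁ : ContDiffAt ℝ ∞ Ring.inverse (loopMatrix γ x) :=
      contDiffAt_ringInverse ℝ (γ x : GL (Fin d) ℂ)
    exact h₁.comp x h.contDiffAt

/-- A smooth loop in `G` as an element of `H^s(S^1, M)`, `M` the algebra of all matrices with the
norm `‖A‖² = tr (A A^*)`. -/
def SmoothLoops.toSobolev (s : ℝ) (γ : SmoothLoops G) :
    Sobolev (Matrix (Fin d) (Fin d) ℂ) s :=
  ⟨fourierCoeff (loopMatrix γ.1), fourierCoeff_mem_sobolevSubmodule s _ γ.2⟩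

/-- `H^s(S^1, G)` as a subset of `H^s(S^1, M)`: the closure of the smooth loops in `G`. -/
def sobolevLoopSet (s : ℝ) : Set (Sobolev (Matrix (Fin d) (Fin d) ℂ) s) :=
  closure (Set.range (SmoothLoops.toSobolev G s))

/-- The space `H^s(S^1, G)`. -/
def SobolevLoops (s : ℝ) : Type := sobolevLoopSet G s

instance (s : ℝ) : MetricSpace (SobolevLoops G s) :=
  inferInstanceAs (MetricSpace (sobolevLoopSet G s))

/-- `H^s(S^1, G)` carries the reflexive completion of the trace diffeology of the Hilbert space
`H^s(S^1, M)`. -/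
instance (s : ℝ) : DiffeologicalSpace (SobolevLoops G s) :=
  LoopDiffeology.reflexiveCompletion (LoopDiffeology.trace (sobolevLoopSet G s))

variable {G} in
/-- The Fourier coefficients of an element of `H^s(S^1, G)`. -/
def SobolevLoops.coeff {s : ℝ} (a : SobolevLoops G s) : ℤ → Matrix (Fin d) (Fin d) ℂ :=
  a.1.coeff

/-- The inclusion of `C^∞(S^1, G)` into `H^s(S^1, G)`. -/
def SobolevLoops.ofSmooth (s : ℝ) (γ : SmoothLoops G) : SobolevLoops G s :=
  ⟨SmoothLoops.toSobolev G s γ, subset_closure (Set.mem_range_self γ)⟩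

/-- The union `H^{1/2,+}(S^1, G)` of the spaces `H^s(S^1, G)`, `s > 1/2`. -/
def SobolevLoopsPlus : Type :=
  {c : ℤ → Matrix (Fin d) (Fin d) ℂ // ∃ s : ℝ, 1 / 2 < s ∧ ∃ a : SobolevLoops G s, a.coeff = c}

variable {G} in
/-- The Fourier coefficients of an element of `H^{1/2,+}(S^1, G)`. -/
def SobolevLoopsPlus.coeff (a : SobolevLoopsPlus G) : ℤ → Matrix (Fin d) (Fin d) ℂ := a.1

/-- The inclusion of `H^s(S^1, G)`, `s > 1/2`, into `H^{1/2,+}(S^1, G)`. -/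
def SobolevLoopsPlus.incl (s : Set.Ioi (1 / 2 : ℝ)) (a : SobolevLoops G s) : SobolevLoopsPlus G :=
  ⟨a.coeff, s, s.2, a, rfl⟩

/-- The inclusion of `C^∞(S^1, G)` into `H^{1/2,+}(S^1, G)`. -/
def SobolevLoopsPlus.ofSmooth (γ : SmoothLoops G) : SobolevLoopsPlus G :=
  SobolevLoopsPlus.incl G ⟨1, by norm_num⟩ (SobolevLoops.ofSmooth G 1 γ)

/-- The inductive limit topology on `H^{1/2,+}(S^1, G)`: the finest one for which the inclusions of
the `H^s(S^1, G)`, `s > 1/2`, are continuous. -/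
instance : TopologicalSpace (SobolevLoopsPlus G) :=
  ⨆ s : Set.Ioi (1 / 2 : ℝ), TopologicalSpace.coinduced (SobolevLoopsPlus.incl G s) inferInstance

/-- The inductive limit diffeology on `H^{1/2,+}(S^1, G)`: the finest one for which the inclusions
of the `H^s(S^1, G)`, `s > 1/2`, are smooth. -/
instance : DiffeologicalSpace (SobolevLoopsPlus G) :=
  .generateFrom {P | ∃ (s : Set.Ioi (1 / 2 : ℝ))
    (q : EuclideanSpace ℝ (Fin P.1) → SobolevLoops G s),
      Diffeology.IsPlot q ∧ P.2 = fun x => SobolevLoopsPlus.incl G s (q x)}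

variable {G} in
/-- A group structure on a space `X` of loops in `G` (given by Fourier coefficients `coeff`) is
pointwise multiplication if each element of `X` is represented by a continuous loop with values
in `G` and the product of `X` is represented by the pointwise product of these loops. -/
def IsPointwiseLoopGroup {X : Type*} (coeff : X → ℤ → Matrix (Fin d) (Fin d) ℂ) [Group X] :
    Prop :=
  ∃ ev : X →* (UnitAddCircle → G), ∀ a : X,
    Continuous (loopMatrix (ev a)) ∧ coeff a = fourierCoeff (loopMatrix (ev a))

/-- An action of `X` on `Y` is a smooth extension of the action of `C^∞(S^1, G)` on itself by
pointwise (left) multiplication, with respect to inclusions `i`, `j` of `C^∞(S^1, G)` in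
`X` and `Y`. -/
structure IsSmoothExtensionOfLoopMul {X Y : Type*} [Group X] [MulAction X Y]
    [TopologicalSpace X] [TopologicalSpace Y] [DiffeologicalSpace X] [DiffeologicalSpace Y]
    (i : SmoothLoops G → X) (j : SmoothLoops G → Y) : Prop where
  smul_eq : ∀ γ η : SmoothLoops G, i γ • j η = j (γ * η)
  continuous_smul : Continuous fun p : X × Y => p.1 • p.2
  dSmooth_smul : Diffeology.DSmooth fun p : X × Y => p.1 • p.2

end Loops

end

/-! Write M for the algebra of all matrices. The analytic core is that multiplication H^k × H^s →
H^s of M-valued Sobolev functions is bounded when k > 1/2 and |s| ≤ k (`Sobolev.mul`), by the weight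
estimate `sobolevWeight_le_mul` and Cauchy–Schwarz. For k > 1/2, evaluation at a point is continuous
on H^k and G is closed in M, so elements of H^k(S^1, G) are continuous loops in G. They are closed
under products by density, and under inverses because a compact group preserves a hermitian form:
g⁻¹ = Q g^* Q⁻¹, a bounded conjugate linear operation on H^k.

The bound |s| ≤ k fails for very negative s, and there compactness of G enters a second time. Loops
in G are uniformly bounded, hence bounded in L² = H^0, and this bound survives closure in H^s by
lower semicontinuity. Interpolating between H^s and H^0 shows that H^s(S^1, G) embeds continuously
into H^σ(S^1, M) for s < σ < 0 (`SobolevLoops.continuous_lift`); interpolating Fourier transforms in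
the plot parameter shows that plots remain smooth in H^σ (`SobolevLoops.contDiff_lift_of_isPlot`).
With σ = max(s, -1/2) one lifts to H^σ, multiplies there, and includes back into H^s.

Plots of the reflexive completion are exactly the maps that are smooth into H^s(S^1, M): continuous
linear functionals are smooth functions, and a scalarwise smooth map into a Banach space is smooth
(`contDiff_of_forall_dual`).

For H^{1/2,+}, a product with an inductive limit is awkward to test directly. The action is
therefore factored through a ↦ T_a with values in the bounded operators on H^σ. As σ does not depend
on k, continuity and smoothness of T can be checked on each H^k, and joint continuity and smoothness
follow from evaluation of operators (`exists_isSmoothExtensionOfLoopMul`). -/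

noncomputable section

/-! ### Scalarwise smooth maps into Banach spaces are smooth -/

section ScalarwiseSmooth

open scoped FourierTransform
open MeasureTheory

variable {V : Type*} [NormedAddCommGroup V] [InnerProductSpace ℝ V] [FiniteDimensional ℝ V]
  {E : Type*} [NormedAddCommGroup E] [NormedSpace ℂ E]

/-- Smoothness is local; cutting off makes the Fourier transform in the parameter available. -/
lemma contDiff_of_contDiff_smul {q : V → E}
    (h : ∀ χ : V → ℝ, ContDiff ℝ ∞ χ → HasCompactSupport χ → ContDiff ℝ ∞ fun x => χ x • q x) :
    ContDiff ℝ ∞ q := by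
  refine contDiff_iff_contDiffAt.mpr fun x => ?_
  let χ : ContDiffBump x := ⟨1, 2, one_pos, one_lt_two⟩
  refine (h χ χ.contDiff χ.hasCompactSupport).contDiffAt.congr_of_eventuallyEq ?_
  filter_upwards [χ.eventuallyEq_one] with y hy
  rw [hy, Pi.one_apply, one_smul]

/-- Uniform boundedness in the bidual: the dual is complete even when `E` is not. -/
lemma exists_norm_le_of_forall_dual {ι : Type*} (z : ι → E)
    (h : ∀ l : E →L[ℂ] ℂ, ∃ C, ∀ i, ‖l (z i)‖ ≤ C) : ∃ C, ∀ i, ‖z i‖ ≤ C := by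
  obtain ⟨C, hC⟩ := banach_steinhaus (g := fun i => NormedSpace.inclusionInDoubleDualLi ℂ (z i))
    (fun l => h l)
  exact ⟨C, fun i => (NormedSpace.inclusionInDoubleDualLi ℂ).norm_map (z i) ▸ hC i⟩

/-- By the mean value inequality the difference quotients at `x₀` are bounded under each functional,
hence bounded in norm, so `q` is Lipschitz at `x₀`. -/
lemma continuous_of_forall_dual_contDiff {q : V → E}
    (h : ∀ l : E →L[ℂ] ℂ, ContDiff ℝ ∞ fun x => l (q x)) : Continuous q := by
  refine continuous_iff_continuousAt.mpr fun x₀ => ?_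
  obtain ⟨C, hC⟩ := exists_norm_le_of_forall_dual
    (fun x : Metric.closedBall x₀ 1 => ((‖(x : V) - x₀‖⁻¹ : ℝ) : ℂ) • (q x - q x₀)) (fun l => by
      obtain ⟨C, hC⟩ := (isCompact_closedBall x₀ 1).exists_bound_of_continuousOn
        ((h l).continuous_fderiv (by simp)).continuousOn
      refine ⟨C, fun x => ?_⟩
      have h0 : 0 ≤ C := (norm_nonneg _).trans (hC x₀ (by simp))
      have := (convex_closedBall x₀ 1).norm_image_sub_le_of_norm_fderiv_le (𝕜 := ℝ)
        (f := fun x => l (q x)) (fun y _ => ((h l).differentiable (by simp)).differentiableAt) hC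
        (Metric.mem_closedBall_self zero_le_one) x.2
      rw [map_smul, map_sub, norm_smul, Complex.norm_real, norm_inv, norm_norm]
      -- At x = x₀ the quotient is 0 because the inverse of 0 is 0.
      rcases (norm_nonneg ((x : V) - x₀)).eq_or_lt with h' | h'
      · rw [← h']; simpa using h0
      · rwa [inv_mul_le_iff₀ h', mul_comm])
  rw [ContinuousAt, tendsto_iff_norm_sub_tendsto_zero]
  have hlim : Filter.Tendsto (fun x => C * ‖x - x₀‖) (nhds x₀) (nhds 0) := by
    have : Continuous fun x => C * ‖x - x₀‖ := by fun_prop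
    simpa using this.tendsto x₀
  refine squeeze_zero' (.of_forall fun _ => norm_nonneg _) ?_ hlim
  filter_upwards [Metric.closedBall_mem_nhds x₀ one_pos] with x hx
  have := hC ⟨x, hx⟩
  simp only [norm_smul, Complex.norm_real, norm_inv, norm_norm] at this
  rcases (norm_nonneg (x - x₀)).eq_or_lt with h' | h'
  · rw [sub_eq_zero.mp (norm_eq_zero.mp h'.symm)]; simp
  · rwa [inv_mul_le_iff₀ h', mul_comm] at this

variable [MeasurableSpace V] [BorelSpace V]

lemma integrable_pow_mul_norm_of_decay {E : Type*} [NormedAddCommGroup E] {g : V → E} (hg : Continuous g)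
    (h : ∀ N : ℕ, ∃ C : ℝ, ∀ ξ, ‖ξ‖ ^ N * ‖g ξ‖ ≤ C) (n : ℕ) :
    Integrable fun ξ => ‖ξ‖ ^ n * ‖g ξ‖ := by
  obtain ⟨C₀, h₀⟩ := h n
  obtain ⟨C₁, h₁⟩ := h (n + (Module.finrank ℝ V + 1))
  have hint := (integrable_one_add_norm (E := V) (μ := volume)
    (r := ((Module.finrank ℝ V + 1 : ℕ) : ℝ)) (by push_cast; linarith)).const_mul
    (2 ^ (Module.finrank ℝ V + 1) * (C₀ + C₁))
  refine hint.mono' (by fun_prop) (.of_forall fun ξ => ?_)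
  set M := Module.finrank ℝ V + 1
  rw [Real.norm_of_nonneg (by positivity), Real.rpow_neg (by positivity), Real.rpow_natCast,
    ← div_eq_mul_inv, le_div_iff₀ (by positivity)]
  have h1 : (1 + ‖ξ‖) ^ M ≤ 2 ^ M * (1 + ‖ξ‖ ^ M) := by
    have hle : (1 + ‖ξ‖) ^ M ≤ (2 * max 1 ‖ξ‖) ^ M := by
      gcongr
      linarith [le_max_left 1 ‖ξ‖, le_max_right 1 ‖ξ‖]
    refine hle.trans ?_
    rw [mul_pow]
    gcongr
    rcases max_cases 1 ‖ξ‖ with h | h <;> rw [h.1]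
    · simp
    · simp
  calc ‖ξ‖ ^ n * ‖g ξ‖ * (1 + ‖ξ‖) ^ M
      ≤ ‖ξ‖ ^ n * ‖g ξ‖ * (2 ^ M * (1 + ‖ξ‖ ^ M)) := by gcongr
    _ = 2 ^ M * (‖ξ‖ ^ n * ‖g ξ‖ + ‖ξ‖ ^ (n + M) * ‖g ξ‖) := by ring
    _ ≤ _ := by gcongr; exacts [h₀ ξ, h₁ ξ]

/-- Fourier inversion writes `f` as the reflected Fourier transform of a function all of whose
moments are integrable, which can be differentiated under the integral. -/
lemma contDiff_of_fourier_decay [CompleteSpace E] {f : V → E} (hf : Continuous f)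
    (hc : HasCompactSupport f) (h : ∀ N : ℕ, ∃ C : ℝ, ∀ ξ, ‖ξ‖ ^ N * ‖𝓕 f ξ‖ ≤ C) :
    ContDiff ℝ ∞ f := by
  have hfi : Integrable f := hf.integrable_of_hasCompactSupport hc
  have hcont : Continuous (𝓕 f) := (Real.contDiff_fourier (N := 0) fun n hn => by
    obtain rfl : n = 0 := by simpa using hn
    simpa using hfi.norm).continuous
  have hI := integrable_pow_mul_norm_of_decay hcont h
  have hFi : Integrable (𝓕 f) := by
    have := hI 0
    simp only [pow_zero, one_mul] at this
    exact (integrable_norm_iff hcont.aestronglyMeasurable).mp this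
  have key : ContDiff ℝ ∞ (𝓕 (𝓕 f)) := Real.contDiff_fourier (N := ⊤) fun n _ => hI n
  have e : f = fun x => 𝓕 (𝓕 f) (-x) := by
    conv_lhs => rw [← hf.fourierInv_fourier_eq hfi hFi]
    funext x
    rw [Real.fourierInv_eq_fourier_neg]
  rw [e]
  exact key.comp contDiff_neg

lemma exists_pow_mul_norm_fourier_le {f : V → E} (hf : ContDiff ℝ ∞ f) (hc : HasCompactSupport f)
    (N : ℕ) : ∃ C : ℝ, ∀ ξ, ‖ξ‖ ^ N * ‖𝓕 f ξ‖ ≤ C := by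
  obtain ⟨C, hC⟩ := (𝓕 (hc.toSchwartzMap hf)).decay N 0
  refine ⟨C, fun ξ => ?_⟩
  have := hC.2 ξ
  rwa [norm_iteratedFDeriv_zero, SchwartzMap.fourier_coe] at this

lemma ContinuousLinearMap.fourier_comp_comm {F : Type*} [NormedAddCommGroup F] [NormedSpace ℂ F]
    [CompleteSpace E] [CompleteSpace F] (L : E →L[ℂ] F) {f : V → E} (hf : Integrable f) (ξ : V) :
    L (𝓕 f ξ) = 𝓕 (fun x => L (f x)) ξ := by
  rw [Real.fourier_eq, Real.fourier_eq, ← L.integral_comp_comm]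
  · simp only [Circle.smul_def, map_smul]
  · exact (Real.fourierIntegral_convergent_iff ξ).mpr hf

/-- A map into a Banach space is smooth if its compositions with the continuous linear functionals
are smooth. -/
theorem contDiff_of_forall_dual [CompleteSpace E] {q : V → E}
    (h : ∀ l : E →L[ℂ] ℂ, ContDiff ℝ ∞ fun x => l (q x)) : ContDiff ℝ ∞ q := by
  have hq := continuous_of_forall_dual_contDiff h
  refine contDiff_of_contDiff_smul fun χ hχ hχc => ?_
  have hf : Continuous fun x => χ x • q x := hχ.continuous.smul hq
  have hfc : HasCompactSupport fun x => χ x • q x := hχc.smul_right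
  refine contDiff_of_fourier_decay hf hfc fun N => ?_
  -- Each functional commutes with the Fourier transform and sees a Schwartz function; uniform
  -- boundedness turns these scalar decay bounds into decay in norm.
  obtain ⟨C, hC⟩ := exists_norm_le_of_forall_dual
    (fun ξ => ((‖ξ‖ ^ N : ℝ) : ℂ) • 𝓕 (fun x => χ x • q x) ξ) (fun l => by
      have e : (fun x => l (χ x • q x)) = fun x => χ x • l (q x) :=
        funext fun x => l.map_smul_of_tower (χ x) (q x)
      obtain ⟨C, hC⟩ := exists_pow_mul_norm_fourier_le (hχ.smul (h l)) hχc.smul_right N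
      refine ⟨C, fun ξ => ?_⟩
      rw [map_smul, l.fourier_comp_comm (hf.integrable_of_hasCompactSupport hfc), e, norm_smul,
        Complex.norm_real, Real.norm_of_nonneg (by positivity)]
      exact hC ξ)
  refine ⟨C, fun ξ => ?_⟩
  have := hC ξ
  rwa [norm_smul, Complex.norm_real, Real.norm_of_nonneg (by positivity)] at this

end ScalarwiseSmooth

/-! ### Estimates in Sobolev spaces -/

section SobolevEstimates

open scoped ENNReal

lemma sobolevWeight_le_of_le {s t : ℝ} (h : s ≤ t) (n : ℤ) :
    sobolevWeight s n ≤ sobolevWeight t n :=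
  Real.rpow_le_rpow_of_exponent_le (by linarith [abs_nonneg (n : ℝ)]) h

lemma summable_sobolevWeight_neg_sq {k : ℝ} (hk : 1 / 2 < k) :
    Summable fun n : ℤ => sobolevWeight (-k) n ^ 2 := by
  have h2 : Summable fun n : ℤ => |(n : ℝ)| ^ (-(2 * k)) :=
    Real.summable_abs_int_rpow (by linarith)
  refine Summable.of_norm_bounded_eventually h2 ?_
  filter_upwards [(Set.finite_singleton (0 : ℤ)).compl_mem_cofinite] with n hn
  have hn' : (0 : ℝ) < |(n : ℝ)| := abs_pos.mpr (by exact_mod_cast hn)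
  rw [Real.norm_of_nonneg (by positivity), sobolevWeight, ← Real.rpow_natCast,
    ← Real.rpow_mul (by positivity)]
  rw [show -k * ((2 : ℕ) : ℝ) = -(2 * k) by push_cast; ring]
  exact Real.rpow_le_rpow_of_nonpos hn' (by linarith) (by linarith)

section SqNorm

variable {V : Type*} [NormedAddCommGroup V]

/-- The square of the `H^s`-norm of a family of Fourier coefficients. -/
def sobolevSqNorm (s : ℝ) (c : ℤ → V) : ℝ≥0∞ :=
  ∑' n, (ENNReal.ofReal (sobolevWeight s n) * ‖c n‖ₑ) ^ 2

lemma sobolevSqNorm_mono {s t : ℝ} (h : s ≤ t) (c : ℤ → V) :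
    sobolevSqNorm s c ≤ sobolevSqNorm t c := by
  refine ENNReal.tsum_le_tsum fun n => ?_
  gcongr
  exact sobolevWeight_le_of_le h n

/-- Interpolation between Sobolev norms, with explicit dependence on a large parameter `τ`. -/
lemma sobolevSqNorm_interpolate {s σ σ' : ℝ} (h₁ : s < σ) (h₂ : σ < σ') {τ : ℝ} (hτ : 1 ≤ τ)
    (c : ℤ → V) :
    sobolevSqNorm σ c ≤ ENNReal.ofReal (τ ^ (-(2 * (σ' - σ)))) * sobolevSqNorm σ' c +
      ENNReal.ofReal (τ ^ (2 * (σ - s))) * sobolevSqNorm s c := by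
  have hτ0 : 0 < τ := by linarith
  unfold sobolevSqNorm
  rw [← ENNReal.tsum_mul_left, ← ENNReal.tsum_mul_left, ← ENNReal.tsum_add]
  refine ENNReal.tsum_le_tsum fun n => ?_
  simp only [mul_pow, ← mul_assoc, ← add_mul]
  gcongr
  simp only [← ENNReal.ofReal_pow (sobolevWeight_pos _ n).le]
  rw [← ENNReal.ofReal_mul (by positivity), ← ENNReal.ofReal_mul (by positivity),
    ← ENNReal.ofReal_add (by positivity) (by positivity)]
  refine ENNReal.ofReal_le_ofReal ?_
  have hx : 0 < 1 + |(n : ℝ)| := by positivity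
  have e : ∀ r : ℝ, sobolevWeight r n ^ 2 = (1 + |(n : ℝ)|) ^ (2 * r) := fun r => by
    rw [sobolevWeight, ← Real.rpow_natCast, ← Real.rpow_mul hx.le]
    push_cast; ring_nf
  simp only [e]
  set x := 1 + |(n : ℝ)|
  -- Frequencies above τ are absorbed by the σ'-norm, those below τ by the s-norm.
  rcases le_total τ x with hx' | hx'
  · refine le_add_of_le_of_nonneg ?_ (by positivity)
    calc x ^ (2 * σ) = x ^ (-(2 * (σ' - σ))) * x ^ (2 * σ') := by
          rw [← Real.rpow_add hx]; ring_nf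
      _ ≤ _ := by
          gcongr ?_ * _
          exact Real.rpow_le_rpow_of_nonpos hτ0 hx' (by linarith)
  · refine le_add_of_nonneg_of_le (by positivity) ?_
    calc x ^ (2 * σ) = x ^ (2 * (σ - s)) * x ^ (2 * s) := by
          rw [← Real.rpow_add hx]; ring_nf
      _ ≤ _ := by
          gcongr ?_ * _
          exact Real.rpow_le_rpow hx.le hx' (by linarith)

lemma lp.tsum_enorm_sq (z : lp (fun _ : ℤ => V) 2) : ∑' n, ‖z n‖ₑ ^ 2 = ‖z‖ₑ ^ 2 := by
  have h : HasSum (fun n => ‖z n‖ ^ 2) (‖z‖ ^ 2) := by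
    have := lp.hasSum_norm (p := 2) (by norm_num) z
    simpa using this
  rw [← ofReal_norm, ← ENNReal.ofReal_pow (norm_nonneg _), ← h.tsum_eq,
    ENNReal.ofReal_tsum_of_nonneg (fun n => by positivity) h.summable]
  refine tsum_congr fun n => ?_
  rw [← ofReal_norm, ENNReal.ofReal_pow (norm_nonneg _)]

end SqNorm

namespace Sobolev

variable {V : Type*} [NormedAddCommGroup V] [NormedSpace ℂ V] {s t : ℝ}

lemma ext {u v : Sobolev V s} (h : u.coeff = v.coeff) : u = v := Subtype.ext h

lemma coeff_add (u v : Sobolev V s) (n : ℤ) : (u + v).coeff n = u.coeff n + v.coeff n := rfl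

lemma coeff_sub (u v : Sobolev V s) (n : ℤ) : (u - v).coeff n = u.coeff n - v.coeff n := rfl

lemma coeff_smul (z : ℂ) (u : Sobolev V s) (n : ℤ) : (z • u).coeff n = z • u.coeff n := rfl

lemma enorm_smul_weight (c : ℤ → V) (n : ℤ) :
    ‖(sobolevWeight s n : ℂ) • c n‖ₑ = ENNReal.ofReal (sobolevWeight s n) * ‖c n‖ₑ := by
  rw [enorm_smul, ← ofReal_norm, Complex.norm_real,
    Real.norm_of_nonneg (sobolevWeight_pos s n).le]

lemma enorm_sq_eq (u : Sobolev V s) : ‖u‖ₑ ^ 2 = sobolevSqNorm s u.coeff := by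
  have h : ‖u‖ₑ = ‖toLp V s u‖ₑ := rfl
  rw [h, ← lp.tsum_enorm_sq]
  exact tsum_congr fun n => by rw [← enorm_smul_weight]; rfl

lemma mem_of_sobolevSqNorm_ne_top {c : ℤ → V} (h : sobolevSqNorm s c ≠ ⊤) :
    c ∈ sobolevSubmodule V s := by
  change Memℓp _ 2
  refine memℓp_gen ?_
  simp only [sobolevSqNorm, ← enorm_smul_weight] at h
  have := ENNReal.summable_toReal h
  refine this.congr fun n => ?_
  simp

variable (s) in
/-- The element of `H^s` with given Fourier coefficients. -/
def mk (c : ℤ → V) (h : sobolevSqNorm s c ≠ ⊤) : Sobolev V s :=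
  ⟨c, mem_of_sobolevSqNorm_ne_top h⟩

lemma coeff_mk (c : ℤ → V) (h : sobolevSqNorm s c ≠ ⊤) : (mk s c h).coeff = c := rfl

lemma sobolevSqNorm_coeff_ne_top (u : Sobolev V s) : sobolevSqNorm s u.coeff ≠ ⊤ := by
  rw [← enorm_sq_eq]; finiteness

lemma norm_le_of_sobolevSqNorm_le (u : Sobolev V s) {C : ℝ} (hC : 0 ≤ C)
    (h : sobolevSqNorm s u.coeff ≤ ENNReal.ofReal (C ^ 2)) : ‖u‖ ≤ C := by
  rw [← enorm_sq_eq, ← ofReal_norm, ← ENNReal.ofReal_pow (norm_nonneg _),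
    ENNReal.ofReal_le_ofReal_iff (by positivity)] at h
  exact le_of_sq_le_sq h hC

lemma ofReal_norm_sq (u : Sobolev V s) : ENNReal.ofReal (‖u‖ ^ 2) = sobolevSqNorm s u.coeff := by
  rw [← enorm_sq_eq, ← ofReal_norm, ← ENNReal.ofReal_pow (norm_nonneg _)]

/-- A family of Fourier coefficients in `H^t` as an element of `H^s`, `s ≤ t`. -/
def restrictIndex (h : s ≤ t) (u : Sobolev V t) : Sobolev V s :=
  mk s u.coeff (ne_top_of_le_ne_top u.sobolevSqNorm_coeff_ne_top (sobolevSqNorm_mono h _))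

lemma coeff_restrictIndex (h : s ≤ t) (u : Sobolev V t) : (u.restrictIndex h).coeff = u.coeff :=
  coeff_mk _ _

lemma norm_restrictIndex_le (h : s ≤ t) (u : Sobolev V t) : ‖u.restrictIndex h‖ ≤ ‖u‖ := by
  refine norm_le_of_sobolevSqNorm_le _ (norm_nonneg _) ?_
  rw [ofReal_norm_sq, coeff_restrictIndex]
  exact sobolevSqNorm_mono h _

lemma restrictIndex_add (h : s ≤ t) (u v : Sobolev V t) :
    (u + v).restrictIndex h = u.restrictIndex h + v.restrictIndex h :=
  ext (funext fun n => by
    rw [coeff_add, coeff_restrictIndex, coeff_restrictIndex, coeff_restrictIndex, coeff_add])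

lemma restrictIndex_smul (h : s ≤ t) (z : ℂ) (u : Sobolev V t) :
    (z • u).restrictIndex h = z • u.restrictIndex h :=
  ext (funext fun n => by
    rw [coeff_smul, coeff_restrictIndex, coeff_restrictIndex, coeff_smul])

variable (V) in
/-- The inclusion of `H^t` into `H^s`, `s ≤ t`. -/
def inclusion (h : s ≤ t) : Sobolev V t →L[ℂ] Sobolev V s :=
  LinearMap.mkContinuous
    (IsLinearMap.mk' (restrictIndex h) ⟨restrictIndex_add h, restrictIndex_smul h⟩) 1 fun u => by
    rw [one_mul]
    exact norm_restrictIndex_le h u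

@[simp]
lemma coeff_inclusion (h : s ≤ t) (u : Sobolev V t) : (inclusion V h u).coeff = u.coeff := by
  rw [inclusion, LinearMap.mkContinuous_apply, IsLinearMap.mk'_apply, coeff_restrictIndex]

lemma norm_coeff_le (u : Sobolev V s) (n : ℤ) : ‖u.coeff n‖ ≤ sobolevWeight (-s) n * ‖u‖ := by
  have h1 : ‖(toLp V s u) n‖ ≤ ‖u‖ := lp.norm_apply_le_norm (by norm_num) (toLp V s u) n
  have h2 : ‖(toLp V s u) n‖ = sobolevWeight s n * ‖u.coeff n‖ := by
    change ‖(sobolevWeight s n : ℂ) • u.coeff n‖ = _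
    rw [norm_smul, Complex.norm_real, Real.norm_of_nonneg (sobolevWeight_pos s n).le]
  have e : sobolevWeight (-s) n = (sobolevWeight s n)⁻¹ := by
    rw [sobolevWeight, Real.rpow_neg (by positivity)]; rfl
  rw [e, inv_mul_eq_div, le_div_iff₀ (sobolevWeight_pos s n), mul_comm, ← h2]
  exact h1

variable (V s) in
/-- The `n`-th Fourier coefficient, as a continuous linear map. -/
def coeffCLM (n : ℤ) : Sobolev V s →L[ℂ] V :=
  LinearMap.mkContinuous
    { toFun := fun u => u.coeff n
      map_add' := fun _ _ => rfl
      map_smul' := fun _ _ => rfl } _ fun u => u.norm_coeff_le n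

lemma toLp_surjective : Function.Surjective (toLp V s) := fun z => by
  have hz : (fun n => (sobolevWeight s n : ℂ) • ((sobolevWeight s n : ℂ)⁻¹ • z n)) = z :=
    funext fun n => smul_inv_smul₀ (Complex.ofReal_ne_zero.mpr (sobolevWeight_pos s n).ne') _
  refine ⟨⟨fun n => (sobolevWeight s n : ℂ)⁻¹ • z n, ?_⟩, ?_⟩
  · change Memℓp _ 2
    rw [hz]
    exact z.2
  · exact Subtype.ext hz

/-- `toLp` is an isometry onto ℓ². -/
instance [CompleteSpace V] : CompleteSpace (Sobolev V s) := by
  have hi : Isometry (toLp V s) := AddMonoidHomClass.isometry_of_norm _ fun _ => rfl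
  have : IsUniformInducing (toLp V s) := hi.isUniformInducing
  exact (this.completeSpace_congr toLp_surjective).mpr inferInstance

end Sobolev

end SobolevEstimates

/-! ### Multiplication of Sobolev functions -/

section SobolevMul

open scoped ENNReal

/-- The larger of x and y is at least z/2, so its power absorbs z^s; the factor that remains is a
power -k of the smaller one, up to a constant. -/
lemma rpow_mul_rpow_neg_le {x y z k s : ℝ} (hx : 1 ≤ x) (hy : 1 ≤ y) (hz : 1 ≤ z)
    (hzxy : z ≤ x + y) (hs : 0 ≤ s) (hsk : s ≤ k) :
    z ^ s * x ^ (-k) * y ^ (-s) ≤ 2 ^ k * (x ^ (-k) + y ^ (-k)) := by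
  have hx0 : 0 < x := by linarith
  have hy0 : 0 < y := by linarith
  have hz0 : 0 < z := by linarith
  have h2 : (2 : ℝ) ^ s ≤ 2 ^ k := Real.rpow_le_rpow_of_exponent_le one_le_two hsk
  rcases le_total x y with h | h
  · calc z ^ s * x ^ (-k) * y ^ (-s) ≤ (2 * y) ^ s * x ^ (-k) * y ^ (-s) := by
          gcongr; linarith
      _ = 2 ^ s * x ^ (-k) * (y ^ s * y ^ (-s)) := by
          rw [Real.mul_rpow zero_le_two hy0.le]; ring
      _ = 2 ^ s * x ^ (-k) := by rw [← Real.rpow_add hy0]; simp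
      _ ≤ 2 ^ k * (x ^ (-k) + y ^ (-k)) := by
          gcongr
          exact le_add_of_nonneg_right (by positivity)
  · calc z ^ s * x ^ (-k) * y ^ (-s) ≤ (2 * x) ^ s * x ^ (-k) * y ^ (-s) := by
          gcongr; linarith
      _ = 2 ^ s * (x ^ s * x ^ (-k)) * y ^ (-s) := by
          rw [Real.mul_rpow zero_le_two hx0.le]; ring
      _ = 2 ^ s * x ^ (s - k) * y ^ (-s) := by rw [← Real.rpow_add hx0]; ring_nf
      _ ≤ 2 ^ k * y ^ (s - k) * y ^ (-s) := by
          gcongr 2 ^ ?_ * ?_ * _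
          · exact one_le_two
          · exact Real.rpow_le_rpow_of_nonpos hy0 h (by linarith)
      _ = 2 ^ k * y ^ (-k) := by rw [mul_assoc, ← Real.rpow_add hy0]; ring_nf
      _ ≤ 2 ^ k * (x ^ (-k) + y ^ (-k)) := by
          gcongr
          exact le_add_of_nonneg_left (by positivity)

/-- For s ≥ 0 this is the preceding inequality with n = (n - m) + m; for s ≤ 0 the roles of n and m
are exchanged. Each of the three summands depends on a single one of n - m, m, n and is square
summable in it once k > 1/2. -/
lemma sobolevWeight_le_mul {k s : ℝ} (hs : |s| ≤ k) (n m : ℤ) :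
    sobolevWeight s n ≤ 2 ^ k * (sobolevWeight (-k) (n - m) + sobolevWeight (-k) m +
      sobolevWeight (-k) n) * (sobolevWeight k (n - m) * sobolevWeight s m) := by
  have hw : ∀ (r : ℝ) (j : ℤ), sobolevWeight (-r) j = (sobolevWeight r j)⁻¹ := fun r j => by
    rw [sobolevWeight, Real.rpow_neg (by positivity)]; rfl
  have hp := sobolevWeight_pos
  have h1 : ∀ j : ℤ, (1 : ℝ) ≤ 1 + |(j : ℝ)| := fun j => by linarith [abs_nonneg (j : ℝ)]
  have key : sobolevWeight s n * sobolevWeight (-k) (n - m) * sobolevWeight (-s) m ≤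
      2 ^ k * (sobolevWeight (-k) (n - m) + sobolevWeight (-k) m + sobolevWeight (-k) n) := by
    rcases le_total 0 s with h | h
    · refine (rpow_mul_rpow_neg_le (h1 (n - m)) (h1 m) (h1 n) ?_ h
        ((le_abs_self s).trans hs)).trans ?_
      · have : |(n : ℝ)| ≤ |(n : ℝ) - m| + |(m : ℝ)| := by
          simpa using abs_add_le ((n : ℝ) - m) m
        push_cast; linarith
      · refine mul_le_mul_of_nonneg_left ?_ (by positivity)
        change sobolevWeight (-k) (n - m) + sobolevWeight (-k) m ≤ _
        linarith [hp (-k) n]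
    · have := rpow_mul_rpow_neg_le (k := k) (h1 (n - m)) (h1 n) (h1 m) ?_ (neg_nonneg.mpr h)
        ((neg_le_abs s).trans hs)
      · rw [neg_neg] at this
        calc _ = _ := by unfold sobolevWeight; ring
          _ ≤ _ := this
          _ ≤ _ := by
            gcongr ?_ * ?_
            change sobolevWeight (-k) (n - m) + sobolevWeight (-k) n ≤ _
            linarith [hp (-k) m]
      · have : |(m : ℝ)| ≤ |(n : ℝ) - m| + |(n : ℝ)| := by
          have := abs_sub_abs_le_abs_sub (m : ℝ) n
          rw [abs_sub_comm] at this
          linarith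
        push_cast; linarith
  have e : sobolevWeight s n = sobolevWeight s n * sobolevWeight (-k) (n - m) *
      sobolevWeight (-s) m * (sobolevWeight k (n - m) * sobolevWeight s m) := by
    rw [hw, hw]
    have := (hp k (n - m)).ne'
    have := (hp s m).ne'
    field_simp
  rw [e]
  have := hp k (n - m)
  have := hp s m
  gcongr

lemma ENNReal.tsum_mul_sq_le {ι : Type*} (a b : ι → ℝ≥0∞) :
    (∑' i, a i * b i) ^ 2 ≤ (∑' i, a i ^ 2) * ∑' i, b i ^ 2 := by
  let _ : MeasurableSpace ι := ⊤
  have := ENNReal.lintegral_mul_le_Lp_mul_Lq (MeasureTheory.Measure.count (α := ι))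
    Real.HolderConjugate.two_two (f := a) (g := b) measurable_from_top.aemeasurable
    measurable_from_top.aemeasurable
  simp only [MeasureTheory.lintegral_count' measurable_from_top, Pi.mul_apply] at this
  calc _ ≤ _ := pow_le_pow_left' this 2
    _ = _ := by
      rw [mul_pow, ← ENNReal.rpow_natCast, ← ENNReal.rpow_mul, ← ENNReal.rpow_natCast,
        ← ENNReal.rpow_mul]
      norm_num

lemma ENNReal.add_add_sq_le (a b c : ℝ≥0∞) :
    (a + b + c) ^ 2 ≤ 3 * (a ^ 2 + b ^ 2 + c ^ 2) := by
  by_cases h : a = ⊤ ∨ b = ⊤ ∨ c = ⊤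
  · have : a ^ 2 + b ^ 2 + c ^ 2 = ⊤ := by
      rcases h with rfl | rfl | rfl <;> simp
    rw [this, ENNReal.mul_top (by norm_num)]
    exact le_top
  · push Not at h
    lift a to NNReal using h.1
    lift b to NNReal using h.2.1
    lift c to NNReal using h.2.2
    norm_cast
    rw [← NNReal.coe_le_coe]
    push_cast
    nlinarith [sq_nonneg ((a : ℝ) - b), sq_nonneg ((a : ℝ) - c), sq_nonneg ((b : ℝ) - c)]

lemma ENNReal.tsum_tsum_sub_mul (a b : ℤ → ℝ≥0∞) :
    ∑' n, ∑' m, a (n - m) * b m = (∑' n, a n) * ∑' m, b m := by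
  rw [ENNReal.tsum_comm, ← ENNReal.tsum_mul_left]
  refine tsum_congr fun m => ?_
  rw [ENNReal.tsum_mul_right]
  congr 1
  exact (Equiv.subRight m).tsum_eq a

lemma tsum_ofReal_sobolevWeight_neg_sq_ne_top {k : ℝ} (hk : 1 / 2 < k) :
    ∑' n, ENNReal.ofReal (sobolevWeight (-k) n) ^ 2 ≠ ⊤ := by
  have := summable_sobolevWeight_neg_sq hk
  simp_rw [← ENNReal.ofReal_pow (sobolevWeight_pos _ _).le]
  exact this.tsum_ofReal_ne_top

/-- Cauchy–Schwarz against (1 + |n|)^(-k). For k > 1/2 it gives absolutely convergent Fourier series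
on H^k. -/
lemma tsum_enorm_sq_le_sobolevSqNorm {V : Type*} [NormedAddCommGroup V] (k : ℝ) (c : ℤ → V) :
    (∑' n, ‖c n‖ₑ) ^ 2 ≤
      (∑' n, ENNReal.ofReal (sobolevWeight (-k) n) ^ 2) * sobolevSqNorm k c := by
  refine le_trans (le_of_eq ?_) (ENNReal.tsum_mul_sq_le _ _)
  congr 1
  refine tsum_congr fun n => ?_
  rw [← mul_assoc, ← ENNReal.ofReal_mul (sobolevWeight_pos _ _).le, sobolevWeight, sobolevWeight,
    ← Real.rpow_add (by positivity)]
  simp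

namespace Sobolev

variable {V : Type*} [NormedAddCommGroup V] [NormedSpace ℂ V] {k : ℝ}

lemma tsum_enorm_coeff_ne_top (hk : 1 / 2 < k) (u : Sobolev V k) : ∑' n, ‖u.coeff n‖ₑ ≠ ⊤ := by
  have h := tsum_enorm_sq_le_sobolevSqNorm k u.coeff
  intro h'
  rw [h', ENNReal.top_pow two_ne_zero, top_le_iff] at h
  have := tsum_ofReal_sobolevWeight_neg_sq_ne_top hk
  have := u.sobolevSqNorm_coeff_ne_top
  exact (by finiteness : _ ≠ ⊤) h

lemma summable_norm_coeff (hk : 1 / 2 < k) (u : Sobolev V k) : Summable fun n => ‖u.coeff n‖ := by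
  simpa using ENNReal.summable_toReal (u.tsum_enorm_coeff_ne_top hk)

lemma tsum_norm_coeff_le (hk : 1 / 2 < k) (u : Sobolev V k) :
    ∑' n, ‖u.coeff n‖ ≤
      √(∑' n, ENNReal.ofReal (sobolevWeight (-k) n) ^ 2).toReal * ‖u‖ := by
  have hS := tsum_ofReal_sobolevWeight_neg_sq_ne_top hk
  have h0 : 0 ≤ ∑' n, ‖u.coeff n‖ := tsum_nonneg fun n => norm_nonneg _
  have h := tsum_enorm_sq_le_sobolevSqNorm k u.coeff
  have e : ∑' n, ‖u.coeff n‖ₑ = ENNReal.ofReal (∑' n, ‖u.coeff n‖) := by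
    rw [ENNReal.ofReal_tsum_of_nonneg (fun n => norm_nonneg _) (u.summable_norm_coeff hk)]
    simp
  rw [e, ← ENNReal.ofReal_toReal hS, ← ofReal_norm_sq, ← ENNReal.ofReal_pow h0,
    ← ENNReal.ofReal_mul ENNReal.toReal_nonneg, ENNReal.ofReal_le_ofReal_iff (by positivity)] at h
  refine le_of_sq_le_sq ?_ (by positivity)
  rwa [mul_pow, Real.sq_sqrt ENNReal.toReal_nonneg]

end Sobolev

variable {A : Type*} [NormedRing A]

/-- The weight estimate splits the convolution into three parts. Where the decaying weight `D` sits
on n - m or m, Cauchy–Schwarz in m isolates ∑ D² and leaves a convolution of squares; where it sits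
on n, it comes out of the inner sum and is summed last. Three equal bounds and (a + b + c)² ≤ 3(a² +
b² + c²) give the 9. -/
lemma tsum_sobolev_conv_sq_le {k s : ℝ} (hs : |s| ≤ k) (f g : ℤ → A) :
    ∑' n, (ENNReal.ofReal (sobolevWeight s n) * ∑' m, ‖f (n - m)‖ₑ * ‖g m‖ₑ) ^ 2 ≤
      ENNReal.ofReal (2 ^ k) ^ 2 * (9 * ∑' n, ENNReal.ofReal (sobolevWeight (-k) n) ^ 2) *
        (sobolevSqNorm k f * sobolevSqNorm s g) := by
  set D : ℤ → ℝ≥0∞ := fun n => ENNReal.ofReal (sobolevWeight (-k) n)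
  set F : ℤ → ℝ≥0∞ := fun n => ENNReal.ofReal (sobolevWeight k n) * ‖f n‖ₑ
  set H : ℤ → ℝ≥0∞ := fun n => ENNReal.ofReal (sobolevWeight s n) * ‖g n‖ₑ
  set S := ∑' n, D n ^ 2
  have hp := sobolevWeight_pos
  have hpt : ∀ n, (ENNReal.ofReal (sobolevWeight s n) * ∑' m, ‖f (n - m)‖ₑ * ‖g m‖ₑ) ≤
      ENNReal.ofReal (2 ^ k) * (∑' m, D (n - m) * (F (n - m) * H m) +
        ∑' m, D m * (F (n - m) * H m) + D n * ∑' m, F (n - m) * H m) := fun n => by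
    rw [← ENNReal.tsum_mul_left, ← ENNReal.tsum_mul_left, ← ENNReal.tsum_add, ← ENNReal.tsum_add,
      ← ENNReal.tsum_mul_left]
    refine ENNReal.tsum_le_tsum fun m => ?_
    have h := ENNReal.ofReal_le_ofReal (sobolevWeight_le_mul hs n m)
    rw [ENNReal.ofReal_mul (by have := hp (-k) n; have := hp (-k) m; have := hp (-k) (n - m); positivity),
      ENNReal.ofReal_mul (by positivity), ENNReal.ofReal_mul (hp _ _).le,
      ENNReal.ofReal_add (add_pos (hp _ _) (hp _ _)).le (hp _ _).le,
      ENNReal.ofReal_add (hp _ _).le (hp _ _).le] at h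
    refine (mul_le_mul_left h (‖f (n - m)‖ₑ * ‖g m‖ₑ)).trans (le_of_eq ?_)
    simp only [D, F, H]
    ring
  have hFH : ∀ n, (∑' m, F (n - m) * H m) ^ 2 ≤ sobolevSqNorm k f * sobolevSqNorm s g := fun n => by
    refine (ENNReal.tsum_mul_sq_le _ _).trans (le_of_eq ?_)
    congr 1
    exact (Equiv.subLeft n).tsum_eq fun m => F m ^ 2
  have h1 : ∀ n, (∑' m, D (n - m) * (F (n - m) * H m)) ^ 2 ≤
      S * ∑' m, F (n - m) ^ 2 * H m ^ 2 := fun n => by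
    refine (ENNReal.tsum_mul_sq_le _ _).trans (le_of_eq ?_)
    congr 1
    · exact (Equiv.subLeft n).tsum_eq fun m => D m ^ 2
    · exact tsum_congr fun m => mul_pow _ _ _
  have h2 : ∀ n, (∑' m, D m * (F (n - m) * H m)) ^ 2 ≤
      S * ∑' m, F (n - m) ^ 2 * H m ^ 2 := fun n => by
    refine (ENNReal.tsum_mul_sq_le _ _).trans (le_of_eq ?_)
    congr 1
    exact tsum_congr fun m => mul_pow _ _ _
  calc _ ≤ ∑' n, ENNReal.ofReal (2 ^ k) ^ 2 * (3 * (S * ∑' m, F (n - m) ^ 2 * H m ^ 2 +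
        S * ∑' m, F (n - m) ^ 2 * H m ^ 2 +
        D n ^ 2 * (sobolevSqNorm k f * sobolevSqNorm s g))) := by
        refine ENNReal.tsum_le_tsum fun n => ?_
        refine (pow_le_pow_left' (hpt n) 2).trans ?_
        rw [mul_pow]
        gcongr
        refine (ENNReal.add_add_sq_le _ _ _).trans ?_
        rw [mul_pow (D n)]
        gcongr
        exacts [h1 n, h2 n, hFH n]
    _ = _ := by
        rw [ENNReal.tsum_mul_left, ENNReal.tsum_mul_left, ENNReal.tsum_add, ENNReal.tsum_add,
          ENNReal.tsum_mul_left, ENNReal.tsum_mul_right,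
          ENNReal.tsum_tsum_sub_mul (fun n => F n ^ 2) (fun n => H n ^ 2)]
        change _ * (3 * (S * (sobolevSqNorm k f * sobolevSqNorm s g) +
          S * (sobolevSqNorm k f * sobolevSqNorm s g) +
          S * (sobolevSqNorm k f * sobolevSqNorm s g))) = _
        ring

/-- The convolution of two families of Fourier coefficients. -/
def conv (f g : ℤ → A) (n : ℤ) : A := ∑' m, f (n - m) * g m

lemma sobolevSqNorm_conv_le {k s : ℝ} (hs : |s| ≤ k) (f g : ℤ → A) :
    sobolevSqNorm s (conv f g) ≤
      ENNReal.ofReal (2 ^ k) ^ 2 * (9 * ∑' n, ENNReal.ofReal (sobolevWeight (-k) n) ^ 2) *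
        (sobolevSqNorm k f * sobolevSqNorm s g) := by
  refine le_trans (ENNReal.tsum_le_tsum fun n => ?_) (tsum_sobolev_conv_sq_le hs f g)
  gcongr
  refine (enorm_tsum_le_tsum_enorm).trans (ENNReal.tsum_le_tsum fun m => ?_)
  exact (ENNReal.coe_le_coe.mpr (nnnorm_mul_le _ _)).trans_eq (ENNReal.coe_mul _ _)

namespace Sobolev

variable [NormedAlgebra ℂ A] [CompleteSpace A] {k s : ℝ}

/-- Bilinearity of `conv` needs true convergence, since `tsum` defaults to 0 otherwise; finiteness
of the preceding bound provides it. -/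
lemma summable_mul (hk : 1 / 2 < k) (hs : |s| ≤ k) (f : Sobolev A k) (g : Sobolev A s) (n : ℤ) :
    Summable fun m => f.coeff (n - m) * g.coeff m := by
  have hK := tsum_ofReal_sobolevWeight_neg_sq_ne_top hk
  have hfin : ∑' n, (ENNReal.ofReal (sobolevWeight s n) *
      ∑' m, ‖f.coeff (n - m)‖ₑ * ‖g.coeff m‖ₑ) ^ 2 ≠ ⊤ := by
    refine ne_top_of_le_ne_top ?_ (tsum_sobolev_conv_sq_le hs f.coeff g.coeff)
    have := f.sobolevSqNorm_coeff_ne_top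
    have := g.sobolevSqNorm_coeff_ne_top
    finiteness
  have h1 := ENNReal.ne_top_of_tsum_ne_top hfin n
  have h2 : ∑' m, ‖f.coeff (n - m)‖ₑ * ‖g.coeff m‖ₑ ≠ ⊤ := fun h => by
    rw [h, ENNReal.mul_top (by simpa using sobolevWeight_pos s n)] at h1
    simp at h1
  refine Summable.of_norm_bounded (ENNReal.summable_toReal h2) fun m => ?_
  simpa using norm_mul_le (f.coeff (n - m)) (g.coeff m)

/-- Multiplication `H^k × H^s → H^s` for `k > 1/2`, `|s| ≤ k`. -/
def mul (hk : 1 / 2 < k) (hs : |s| ≤ k) : Sobolev A k →L[ℂ] Sobolev A s →L[ℂ] Sobolev A s :=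
  have hfin (f : Sobolev A k) (g : Sobolev A s) : sobolevSqNorm s (conv f.coeff g.coeff) ≠ ⊤ := by
    have hK := tsum_ofReal_sobolevWeight_neg_sq_ne_top hk
    refine ne_top_of_le_ne_top ?_ (sobolevSqNorm_conv_le hs f.coeff g.coeff)
    have := f.sobolevSqNorm_coeff_ne_top
    have := g.sobolevSqNorm_coeff_ne_top
    finiteness
  LinearMap.mkContinuous₂ (LinearMap.mk₂ ℂ (fun f g => Sobolev.mk s (conv f.coeff g.coeff) (hfin f g))
    (fun f f' g => Sobolev.ext (funext fun n => by
      rw [coeff_add]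
      simp only [coeff_mk, conv]
      rw [← (summable_mul hk hs f g n).tsum_add (summable_mul hk hs f' g n)]
      exact tsum_congr fun m => by rw [coeff_add, add_mul]))
    (fun z f g => Sobolev.ext (funext fun n => by
      rw [coeff_smul]
      simp only [coeff_mk, conv]
      rw [← (summable_mul hk hs f g n).tsum_const_smul]
      exact tsum_congr fun m => by rw [coeff_smul, smul_mul_assoc]))
    (fun f g g' => Sobolev.ext (funext fun n => by
      rw [coeff_add]
      simp only [coeff_mk, conv]
      rw [← (summable_mul hk hs f g n).tsum_add (summable_mul hk hs f g' n)]
      exact tsum_congr fun m => by rw [coeff_add, mul_add]))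
    (fun z f g => Sobolev.ext (funext fun n => by
      rw [coeff_smul]
      simp only [coeff_mk, conv]
      rw [← (summable_mul hk hs f g n).tsum_const_smul]
      exact tsum_congr fun m => by rw [coeff_smul, mul_smul_comm])))
    (Real.sqrt (ENNReal.ofReal (2 ^ k) ^ 2 *
      (9 * ∑' n, ENNReal.ofReal (sobolevWeight (-k) n) ^ 2)).toReal) fun f g => by
    have hK := tsum_ofReal_sobolevWeight_neg_sq_ne_top hk
    refine norm_le_of_sobolevSqNorm_le _ (by positivity) ?_
    refine (sobolevSqNorm_conv_le hs f.coeff g.coeff).trans (le_of_eq ?_)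
    rw [mul_pow, mul_pow, Real.sq_sqrt ENNReal.toReal_nonneg, mul_assoc _ (‖f‖ ^ 2),
      ENNReal.ofReal_mul ENNReal.toReal_nonneg, ENNReal.ofReal_mul (by positivity),
      ofReal_norm_sq, ofReal_norm_sq, ENNReal.ofReal_toReal (by finiteness)]

@[simp]
lemma coeff_mul (hk : 1 / 2 < k) (hs : |s| ≤ k) (f : Sobolev A k) (g : Sobolev A s) :
    (mul hk hs f g).coeff = conv f.coeff g.coeff := rfl

end Sobolev

end SobolevMul

/-! ### Fourier series of vector valued functions on the circle -/

section FourierSeries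

open MeasureTheory AddCircle

variable {V : Type*} [NormedAddCommGroup V] [NormedSpace ℂ V]

lemma Continuous.integrable_of_compactSpace {X E : Type*} [TopologicalSpace X] [CompactSpace X]
    [MeasurableSpace X] [OpensMeasurableSpace X] [NormedAddCommGroup E] {f : X → E}
    (hf : Continuous f) (μ : Measure X) [IsFiniteMeasureOnCompacts μ] : Integrable f μ :=
  hf.integrable_of_hasCompactSupport (.of_compactSpace _)

lemma norm_fourier_smul (n : ℤ) (t : UnitAddCircle) (v : V) : ‖fourier n t • v‖ = ‖v‖ := by
  rw [norm_smul, fourier_apply, Circle.norm_coe, one_mul]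

lemma continuous_fourierSeries [CompleteSpace V] {c : ℤ → V} (hc : Summable fun n => ‖c n‖) :
    Continuous fun t : UnitAddCircle => ∑' n, fourier n t • c n :=
  continuous_tsum (fun _ => (map_continuous _).smul continuous_const) hc
    fun _ _ => (norm_fourier_smul _ _ _).le

lemma fourierCoeff_fourier_smul_const [CompleteSpace V] (m n : ℤ) (v : V) :
    fourierCoeff (fun t : UnitAddCircle => fourier m t • v) n = if n = m then v else 0 := by
  have h := congrFun (fourierCoeff_fourier (T := 1) m) n
  rw [fourierCoeff] at h ⊢
  simp_rw [← mul_smul]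
  rw [integral_smul_const]
  simp only [smul_eq_mul] at h
  rw [h, Pi.single_apply]
  split_ifs <;> simp

lemma fourierCoeff_fourierSeries [CompleteSpace V] {c : ℤ → V} (hc : Summable fun n => ‖c n‖) :
    fourierCoeff (fun t : UnitAddCircle => ∑' n, fourier n t • c n) = c := by
  funext n
  have hcont : ∀ m, Continuous fun t : UnitAddCircle => fourier (-n) t • fourier m t • c m :=
    fun m => (map_continuous _).smul ((map_continuous _).smul continuous_const)
  have h := hasSum_integral_of_summable_integral_norm (μ := haarAddCircle)
    (F := fun (m : ℤ) (t : UnitAddCircle) => fourier (-n) t • fourier m t • c m)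
    (fun m => (hcont m).integrable_of_compactSpace _)
    (by simpa only [norm_fourier_smul, integral_const, probReal_univ, one_smul] using hc)
  have e : ∀ t : UnitAddCircle, ∑' m, fourier (-n) t • fourier m t • c m =
      fourier (-n) t • ∑' m, fourier m t • c m := fun t =>
    Summable.tsum_const_smul _ (.of_norm (by simpa only [norm_fourier_smul] using hc))
  simp_rw [e] at h
  refine h.unique ?_
  have e' : ∀ m, ∫ t : UnitAddCircle, fourier (-n) t • fourier m t • c m ∂haarAddCircle =
      if m = n then c n else 0 := fun m => by
    have h := fourierCoeff_fourier_smul_const m n (c m)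
    rw [fourierCoeff] at h
    rw [h]
    split_ifs with h₁ h₂ h₂
    · rw [h₁]
    · exact absurd h₁.symm h₂
    · exact absurd h₂.symm h₁
    · rfl
  simp_rw [e']
  exact hasSum_ite_eq n (c n)

lemma ContinuousLinearMap.fourierCoeff_comp {F : Type*} [NormedAddCommGroup F] [NormedSpace ℂ F]
    [CompleteSpace V] [CompleteSpace F] (L : V →L[ℂ] F) {f : UnitAddCircle → V} (hf : Continuous f)
    (n : ℤ) : fourierCoeff (fun t => L (f t)) n = L (fourierCoeff f n) := by
  rw [fourierCoeff, fourierCoeff, ← L.integral_comp_comm]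
  · simp only [map_smul]
  · exact ((map_continuous _).smul hf).integrable_of_compactSpace _

/-- Functionals separate points and commute with coefficients and series, which reduces the claim to
scalar functions. -/
lemma fourierSeries_fourierCoeff [CompleteSpace V] {f : UnitAddCircle → V} (hf : Continuous f)
    (hs : Summable fun n => ‖fourierCoeff f n‖) (t : UnitAddCircle) :
    ∑' n, fourier n t • fourierCoeff f n = f t := by
  refine (SeparatingDual.eq_iff_forall_dual_eq (R := ℂ)).mpr fun l => ?_
  have hsum : Summable fun n => fourier n t • fourierCoeff f n :=
    .of_norm (by simpa only [norm_fourier_smul] using hs)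
  rw [l.map_tsum hsum]
  let g : C(UnitAddCircle, ℂ) := ⟨fun t => l (f t), l.continuous.comp hf⟩
  have hg : fourierCoeff g = fun n => l (fourierCoeff f n) := funext fun n => l.fourierCoeff_comp hf n
  have := has_pointwise_sum_fourier_series_of_summable (f := g) (by
    rw [hg]
    exact .of_norm_bounded (hs.mul_left ‖l‖) fun n => l.le_opNorm _) t
  rw [hg] at this
  rw [← show g t = l (f t) from rfl, ← this.tsum_eq]
  exact tsum_congr fun n => by rw [map_smul, smul_eq_mul, mul_comm, smul_eq_mul]

lemma eq_of_fourierCoeff_eq [CompleteSpace V] {f g : UnitAddCircle → V} (hf : Continuous f)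
    (hg : Continuous g) (hs : Summable fun n => ‖fourierCoeff f n‖)
    (h : fourierCoeff f = fourierCoeff g) : f = g := funext fun t => by
  rw [← fourierSeries_fourierCoeff hf hs, h, fourierSeries_fourierCoeff hg (h ▸ hs)]

variable {A : Type*} [NormedRing A]

/-- The shear `(n, m) ↦ (n - m, m)`. -/
def subProdEquiv : ℤ × ℤ ≃ ℤ × ℤ where
  toFun p := (p.1 - p.2, p.2)
  invFun p := (p.1 + p.2, p.2)
  left_inv p := by simp
  right_inv p := by simp

lemma summable_norm_conv_prod {a b : ℤ → A} (ha : Summable fun n => ‖a n‖)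
    (hb : Summable fun n => ‖b n‖) :
    Summable fun p : ℤ × ℤ => ‖a (p.1 - p.2) * b p.2‖ := by
  have h : Summable fun p : ℤ × ℤ => ‖a p.1 * b p.2‖ := ha.mul_norm hb
  simpa only [Function.comp_def, subProdEquiv, Equiv.coe_fn_mk] using
    h.comp_injective subProdEquiv.injective

lemma summable_norm_conv {a b : ℤ → A} (ha : Summable fun n => ‖a n‖)
    (hb : Summable fun n => ‖b n‖) : Summable fun n => ‖conv a b n‖ := by
  have h := summable_norm_conv_prod ha hb
  have h₁ : ∀ n, Summable fun m => ‖a (n - m) * b m‖ := fun n => h.prod_factor n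
  have h₂ : Summable fun n => ∑' m, ‖a (n - m) * b m‖ := h.prod
  exact .of_nonneg_of_le (fun n => norm_nonneg _) (fun n => norm_tsum_le_tsum_norm (h₁ n)) h₂

variable [NormedAlgebra ℂ A] [CompleteSpace A]

/-- The double series of the product converges absolutely, so it may be summed along the shear (n,
m) ↦ (n - m, m). -/
lemma fourierSeries_conv {a b : ℤ → A} (ha : Summable fun n => ‖a n‖)
    (hb : Summable fun n => ‖b n‖) (t : UnitAddCircle) :
    ∑' n, fourier n t • conv a b n = (∑' n, fourier n t • a n) * ∑' n, fourier n t • b n := by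
  have hprod := summable_norm_conv_prod ha hb
  have hfac : ∀ n, Summable fun m => ‖a (n - m) * b m‖ := fun n => hprod.prod_factor n
  rw [tsum_mul_tsum_of_summable_norm (by simpa only [norm_fourier_smul] using ha)
    (by simpa only [norm_fourier_smul] using hb),
    ← subProdEquiv.tsum_eq fun p : ℤ × ℤ => fourier p.1 t • a p.1 * fourier p.2 t • b p.2]
  have hterm : ∀ n m : ℤ, fourier (n - m) t • a (n - m) * fourier m t • b m =
      fourier n t • (a (n - m) * b m) := fun n m => by
    rw [smul_mul_smul_comm, ← fourier_add, sub_add_cancel]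
  have hs : Summable fun p : ℤ × ℤ => fourier p.1 t • (a (p.1 - p.2) * b p.2) :=
    .of_norm (by simpa only [norm_fourier_smul] using hprod)
  simp only [subProdEquiv, Equiv.coe_fn_mk, hterm]
  rw [hs.tsum_prod]
  refine tsum_congr fun n => ?_
  exact (Summable.tsum_const_smul _ (Summable.of_norm (hfac n))).symm

lemma fourierCoeff_mul {f g : UnitAddCircle → A} (hf : Continuous f) (hg : Continuous g)
    (hfs : Summable fun n => ‖fourierCoeff f n‖) (hgs : Summable fun n => ‖fourierCoeff g n‖) :
    fourierCoeff (fun t => f t * g t) = conv (fourierCoeff f) (fourierCoeff g) := by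
  have hs : Summable fun n => ‖conv (fourierCoeff f) (fourierCoeff g) n‖ :=
    summable_norm_conv hfs hgs
  have e : (fun t => f t * g t) =
      fun t => ∑' n, fourier n t • conv (fourierCoeff f) (fourierCoeff g) n := funext fun t => by
    rw [fourierSeries_conv hfs hgs, fourierSeries_fourierCoeff hf hfs,
      fourierSeries_fourierCoeff hg hgs]
  rw [e]
  exact fourierCoeff_fourierSeries hs

/-! ### Parseval's identity and the H^0-norm of bounded matrix loops -/

lemma tsum_enorm_fourierCoeff_sq_le {f : UnitAddCircle → ℂ} (hf : Continuous f) {C : ℝ}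
    (hC : ∀ t, ‖f t‖ ≤ C) : ∑' n, ‖fourierCoeff f n‖ₑ ^ 2 ≤ ENNReal.ofReal (C ^ 2) := by
  let g : C(UnitAddCircle, ℂ) := ⟨f, hf⟩
  have h := hasSum_sq_fourierCoeff (ContinuousMap.toLp 2 haarAddCircle ℂ g)
  simp only [fourierCoeff_toLp, show fourierCoeff g = fourierCoeff f from rfl] at h
  have e : ∑' n, ‖fourierCoeff f n‖ₑ ^ 2 = ENNReal.ofReal (∑' n, ‖fourierCoeff f n‖ ^ 2) := by
    rw [ENNReal.ofReal_tsum_of_nonneg (fun n => by positivity) h.summable]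
    exact tsum_congr fun n => by rw [ENNReal.ofReal_pow (norm_nonneg _), ofReal_norm]
  rw [e, h.tsum_eq]
  refine ENNReal.ofReal_le_ofReal ?_
  have hae : (ContinuousMap.toLp 2 haarAddCircle ℂ g : UnitAddCircle → ℂ) =ᵐ[haarAddCircle] g :=
    ContinuousMap.coeFn_toLp _ _
  rw [integral_congr_ae (hae.mono fun t ht => by
    simp only [ht]
    rfl : _ =ᵐ[haarAddCircle] fun t => ‖f t‖ ^ 2)]
  have hi : Integrable (fun t => ‖f t‖ ^ 2) (haarAddCircle (T := 1)) :=
    (hf.norm.pow 2).integrable_of_compactSpace _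
  refine (integral_mono hi (integrable_const (C ^ 2)) fun t => ?_).trans_eq (by simp)
  exact pow_le_pow_left₀ (norm_nonneg _) (hC t) 2

lemma Matrix.norm_sq_eq_frobenius {d : ℕ} (M : Matrix (Fin d) (Fin d) ℂ) :
    ‖M‖ ^ 2 = ∑ i, ∑ j, ‖M i j‖ ^ 2 := by
  rw [Matrix.frobenius_norm_def, ← Real.sqrt_eq_rpow, Real.sq_sqrt (by positivity)]
  simp

lemma Matrix.norm_apply_le_frobenius {d : ℕ} (M : Matrix (Fin d) (Fin d) ℂ) (i j : Fin d) :
    ‖M i j‖ ≤ ‖M‖ := by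
  refine le_of_sq_le_sq ?_ (norm_nonneg _)
  rw [M.norm_sq_eq_frobenius]
  exact (Finset.single_le_sum (f := fun j => ‖M i j‖ ^ 2) (fun _ _ => by positivity)
    (Finset.mem_univ j)).trans (Finset.single_le_sum (f := fun i => ∑ j, ‖M i j‖ ^ 2)
      (fun _ _ => Finset.sum_nonneg fun _ _ => by positivity) (Finset.mem_univ i))

lemma Matrix.enorm_sq_eq_frobenius {d : ℕ} (M : Matrix (Fin d) (Fin d) ℂ) :
    ‖M‖ₑ ^ 2 = ∑ i, ∑ j, ‖M i j‖ₑ ^ 2 := by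
  rw [← ofReal_norm, ← ENNReal.ofReal_pow (norm_nonneg _), M.norm_sq_eq_frobenius,
    ENNReal.ofReal_sum_of_nonneg fun _ _ => Finset.sum_nonneg fun _ _ => by positivity]
  refine Finset.sum_congr rfl fun i _ => ?_
  rw [ENNReal.ofReal_sum_of_nonneg fun _ _ => by positivity]
  exact Finset.sum_congr rfl fun j _ => by rw [ENNReal.ofReal_pow (norm_nonneg _), ofReal_norm]

/-- Parseval in each of the d² entries. The constant is crude; only its dependence on the sup bound
alone matters. -/
lemma sobolevSqNorm_zero_fourierCoeff_le {d : ℕ} {f : UnitAddCircle → Matrix (Fin d) (Fin d) ℂ}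
    (hf : Continuous f) {C : ℝ} (hC : ∀ t, ‖f t‖ ≤ C) :
    sobolevSqNorm 0 (fourierCoeff f) ≤ (d : ENNReal) * (d * ENNReal.ofReal (C ^ 2)) := by
  have hw : ∀ n, ENNReal.ofReal (sobolevWeight 0 n) = 1 := fun n => by simp [sobolevWeight]
  simp only [sobolevSqNorm, hw, one_mul]
  have hent : ∀ i j n, fourierCoeff (fun t => f t i j) n = fourierCoeff f n i j := fun i j n =>
    (LinearMap.toContinuousLinearMap (Matrix.entryLinearMap ℂ ℂ i j)).fourierCoeff_comp hf n
  calc ∑' n, ‖fourierCoeff f n‖ₑ ^ 2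
      ≤ ∑' n, ∑ i, ∑ j, ‖fourierCoeff (fun t => f t i j) n‖ₑ ^ 2 := by
        refine ENNReal.tsum_le_tsum fun n => ?_
        simp only [hent]
        exact (Matrix.enorm_sq_eq_frobenius _).le
    _ = ∑ i, ∑ j, ∑' n, ‖fourierCoeff (fun t => f t i j) n‖ₑ ^ 2 := by
        rw [Summable.tsum_finsetSum fun i _ => ENNReal.summable]
        exact Finset.sum_congr rfl fun i _ =>
          Summable.tsum_finsetSum fun j _ => ENNReal.summable
    _ ≤ ∑ _i : Fin d, ∑ _j : Fin d, ENNReal.ofReal (C ^ 2) := by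
        gcongr with i _ j _
        refine tsum_enorm_fourierCoeff_sq_le ?_ fun t =>
          (Matrix.norm_apply_le_frobenius _ i j).trans (hC t)
        exact (LinearMap.toContinuousLinearMap
          (Matrix.entryLinearMap ℂ ℂ i j)).continuous.comp hf
    _ = _ := by simp

end FourierSeries

/-! ### Inversion in a compact matrix group -/

section Average

open MeasureTheory
open scoped Matrix ComplexOrder

variable {d : ℕ} {G : Subgroup (GL (Fin d) ℂ)}

lemma continuous_subgroup_val :
    Continuous fun g : G => ((g : GL (Fin d) ℂ) : Matrix (Fin d) (Fin d) ℂ) :=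
  Units.continuous_val.comp continuous_subtype_val

/-- A compact matrix group preserves a nondegenerate hermitian form. -/
lemma exists_isUnit_forall_mul_mul_conjTranspose_eq (hG : IsCompact (G : Set (GL (Fin d) ℂ))) :
    ∃ Q : Matrix (Fin d) (Fin d) ℂ, IsUnit Q.det ∧
      ∀ g : G, ((g : GL (Fin d) ℂ) : Matrix (Fin d) (Fin d) ℂ) * Q *
        ((g : GL (Fin d) ℂ) : Matrix (Fin d) (Fin d) ℂ)ᴴ = Q := by
  have : CompactSpace G := isCompact_iff_compactSpace.mp hG
  let _ : MeasurableSpace G := borel G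
  have : BorelSpace G := ⟨rfl⟩
  let μ : Measure G := Measure.haar
  let ι : G → Matrix (Fin d) (Fin d) ℂ := fun g => ((g : GL (Fin d) ℂ) : Matrix (Fin d) (Fin d) ℂ)
  have hι : Continuous ι := continuous_subgroup_val
  have hcont : Continuous fun g => ι g * (ι g)ᴴ := hι.mul hι.matrix_conjTranspose
  have hint := hcont.integrable_of_compactSpace (E := Matrix (Fin d) (Fin d) ℂ) μ
  -- Haar averaging: the integrand is positive definite, so a kernel vector x would make the
  -- positive integral of x^* g g^* x vanish.
  refine ⟨∫ g, ι g * (ι g)ᴴ ∂μ, ?_, fun h => ?_⟩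
  · rw [isUnit_iff_ne_zero, ne_eq, ← Matrix.exists_mulVec_eq_zero_iff]
    rintro ⟨x, hx, h0⟩
    let l : Matrix (Fin d) (Fin d) ℂ →ₗ[ℝ] ℝ :=
      { toFun := fun M => (star x ⬝ᵥ M *ᵥ x).re
        map_add' := fun M N => by simp [Matrix.add_mulVec]
        map_smul' := fun r M => by simp [Matrix.smul_mulVec] }
    have hl : ∫ g, l (ι g * (ι g)ᴴ) ∂μ = l (∫ g, ι g * (ι g)ᴴ ∂μ) :=
      (LinearMap.toContinuousLinearMap l).integral_comp_comm hint
    have hpos : ∀ g, 0 < l (ι g * (ι g)ᴴ) := fun g => by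
      have hg : IsUnit (ι g) := (g : GL (Fin d) ℂ).isUnit
      exact (Matrix.PosDef.mul_conjTranspose_self (ι g)
        (Matrix.vecMul_injective_of_isUnit hg)).re_dotProduct_pos hx
    have : 0 < ∫ g, l (ι g * (ι g)ᴴ) ∂μ :=
      ((LinearMap.toContinuousLinearMap l).continuous.comp hcont).integral_pos_of_hasCompactSupport_nonneg_nonzero
        (.of_compactSpace _) (fun g => (hpos g).le) (x := 1) (hpos 1).ne'
    rw [hl] at this
    simp [l, h0] at this
  · change ι h * _ * (ι h)ᴴ = _
    let L : Matrix (Fin d) (Fin d) ℂ →ₗ[ℝ] Matrix (Fin d) (Fin d) ℂ :=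
      { toFun := fun M => ι h * M * (ι h)ᴴ
        map_add' := fun M N => by rw [mul_add, add_mul]
        map_smul' := fun r M => by simp }
    have hL : ∫ g, L (ι g * (ι g)ᴴ) ∂μ = L (∫ g, ι g * (ι g)ᴴ ∂μ) :=
      (LinearMap.toContinuousLinearMap L).integral_comp_comm hint
    change L _ = _
    -- Invariance of the form is left invariance of Haar measure, as (hg)(hg)^* = h (g g^*) h^*.
    rw [← hL, ← integral_mul_left_eq_self (μ := μ) (fun g => ι g * (ι g)ᴴ) h]
    congr 1
    funext g
    have : ι (h * g) = ι h * ι g := rfl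
    rw [this, Matrix.conjTranspose_mul]
    simp only [L, LinearMap.coe_mk, AddHom.coe_mk, mul_assoc]

/-- In a compact matrix group, inversion is given by a conjugate linear map. -/
lemma exists_inv_eq_mul_conjTranspose_mul (hG : IsCompact (G : Set (GL (Fin d) ℂ))) :
    ∃ P Q : Matrix (Fin d) (Fin d) ℂ, ∀ g : G,
      (((g⁻¹ : G) : GL (Fin d) ℂ) : Matrix (Fin d) (Fin d) ℂ) =
        P * ((g : GL (Fin d) ℂ) : Matrix (Fin d) (Fin d) ℂ)ᴴ * Q := by
  obtain ⟨Q, hQ, h⟩ := exists_isUnit_forall_mul_mul_conjTranspose_eq hG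
  refine ⟨Q, Q⁻¹, fun g => ?_⟩
  have h1 : ((g : GL (Fin d) ℂ) : Matrix (Fin d) (Fin d) ℂ) *
      (Q * ((g : GL (Fin d) ℂ) : Matrix (Fin d) (Fin d) ℂ)ᴴ * Q⁻¹) = 1 := by
    rw [← mul_assoc, ← mul_assoc, h, Matrix.mul_nonsing_inv _ hQ]
  exact Units.inv_eq_of_mul_eq_one_right h1

end Average

namespace Sobolev

open scoped Matrix

variable {d : ℕ} {s : ℝ}

/-- Taking adjoints reflects frequencies, and the weight is even in n. -/
lemma sobolevSqNorm_mul_conjTranspose_mul_le (P Q : Matrix (Fin d) (Fin d) ℂ)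
    (c : ℤ → Matrix (Fin d) (Fin d) ℂ) :
    sobolevSqNorm s (fun n => P * (c (-n))ᴴ * Q) ≤
      ENNReal.ofReal ((‖P‖ * ‖Q‖) ^ 2) * sobolevSqNorm s c := by
  rw [sobolevSqNorm, sobolevSqNorm, ← (Equiv.neg ℤ).tsum_eq, ← ENNReal.tsum_mul_left]
  refine ENNReal.tsum_le_tsum fun n => ?_
  have hw : sobolevWeight s (-n) = sobolevWeight s n := by simp [sobolevWeight]
  have hn : ‖P * (c n)ᴴ * Q‖ₑ ≤ ENNReal.ofReal (‖P‖ * ‖Q‖) * ‖c n‖ₑ := by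
    rw [← ofReal_norm, ← ofReal_norm, ← ENNReal.ofReal_mul (by positivity)]
    refine ENNReal.ofReal_le_ofReal ?_
    calc _ ≤ ‖P‖ * ‖(c n)ᴴ‖ * ‖Q‖ := norm_mul₃_le
      _ = _ := by rw [Matrix.frobenius_norm_conjTranspose]; ring
  rw [ENNReal.ofReal_pow (by positivity), ← mul_pow]
  simp only [Equiv.neg_apply, neg_neg, hw]
  have := mul_le_mul_right hn (ENNReal.ofReal (sobolevWeight s n))
  refine pow_le_pow_left' (this.trans_eq ?_) 2
  ring

/-- The map `f ↦ P f^* Q` on `H^s(S^1, M)`. -/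
def mulConjTransposeMul (P Q : Matrix (Fin d) (Fin d) ℂ)
    (u : Sobolev (Matrix (Fin d) (Fin d) ℂ) s) : Sobolev (Matrix (Fin d) (Fin d) ℂ) s :=
  mk s (fun n => P * (u.coeff (-n))ᴴ * Q)
    (ne_top_of_le_ne_top (by have := u.sobolevSqNorm_coeff_ne_top; finiteness)
      (sobolevSqNorm_mul_conjTranspose_mul_le P Q u.coeff))

lemma coeff_mulConjTransposeMul (P Q : Matrix (Fin d) (Fin d) ℂ)
    (u : Sobolev (Matrix (Fin d) (Fin d) ℂ) s) :
    (mulConjTransposeMul P Q u).coeff = fun n => P * (u.coeff (-n))ᴴ * Q := rfl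

lemma continuous_mulConjTransposeMul (P Q : Matrix (Fin d) (Fin d) ℂ) :
    Continuous (mulConjTransposeMul P Q : Sobolev (Matrix (Fin d) (Fin d) ℂ) s → _) := by
  let J : Sobolev (Matrix (Fin d) (Fin d) ℂ) s →+ Sobolev (Matrix (Fin d) (Fin d) ℂ) s :=
    AddMonoidHom.mk' (mulConjTransposeMul P Q) fun u v => ext (funext fun n => by
      rw [coeff_add]
      simp only [coeff_mulConjTransposeMul, coeff_add, Matrix.conjTranspose_add, mul_add, add_mul])
  refine AddMonoidHomClass.continuous_of_bound J (‖P‖ * ‖Q‖) fun u => ?_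
  refine norm_le_of_sobolevSqNorm_le _ (by positivity) ?_
  rw [mul_pow, ENNReal.ofReal_mul (by positivity), ofReal_norm_sq]
  exact sobolevSqNorm_mul_conjTranspose_mul_le P Q u.coeff

end Sobolev

/-- The map is only real linear: it commutes with the integral but conjugates the character, whence
the frequency -n. -/
lemma fourierCoeff_mul_conjTranspose_mul {d : ℕ} (P Q : Matrix (Fin d) (Fin d) ℂ)
    {f : UnitAddCircle → Matrix (Fin d) (Fin d) ℂ} (hf : Continuous f) (n : ℤ) :
    fourierCoeff (fun t => P * (f t).conjTranspose * Q) n =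
      P * (fourierCoeff f (-n)).conjTranspose * Q := by
  let L : Matrix (Fin d) (Fin d) ℂ →ₗ[ℝ] Matrix (Fin d) (Fin d) ℂ :=
    { toFun := fun M => P * M.conjTranspose * Q
      map_add' := fun M N => by rw [Matrix.conjTranspose_add, mul_add, add_mul]
      map_smul' := fun r M => by simp [Matrix.conjTranspose_smul] }
  have h := (LinearMap.toContinuousLinearMap L).integral_comp_comm
    (φ := fun t => fourier (-(-n)) t • f t) (μ := AddCircle.haarAddCircle (T := 1))
    (((map_continuous (fourier (-(-n)))).smul hf).integrable_of_compactSpace _)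
  change _ = L (fourierCoeff f (-n))
  refine Eq.trans ?_ h
  rw [fourierCoeff]
  congr 1
  funext t
  change _ = P * (fourier (-(-n)) t • f t).conjTranspose * Q
  rw [Matrix.conjTranspose_smul, Matrix.mul_smul, Matrix.smul_mul, neg_neg, fourier_neg]
  rfl

/-! ### Loops in a compact matrix group -/

namespace Sobolev

variable {V : Type*} [NormedAddCommGroup V] [NormedSpace ℂ V] [CompleteSpace V] {k : ℝ}

variable (V) in
/-- Evaluation at a point, as a continuous linear map on `H^k`, `k > 1/2`. -/
def evalCLM (hk : 1 / 2 < k) (t : UnitAddCircle) : Sobolev V k →L[ℂ] V :=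
  have hs (u : Sobolev V k) : Summable fun n => fourier n t • u.coeff n :=
    .of_norm (by simpa only [norm_fourier_smul] using u.summable_norm_coeff hk)
  LinearMap.mkContinuous
    { toFun := fun u => ∑' n, fourier n t • u.coeff n
      map_add' := fun u v => by
        rw [← (hs u).tsum_add (hs v)]
        exact tsum_congr fun n => by rw [coeff_add, smul_add]
      map_smul' := fun z u => by
        rw [← (hs u).tsum_const_smul]
        exact tsum_congr fun n => by rw [coeff_smul, smul_comm, RingHom.id_apply] } _ fun u => by
    refine le_trans ?_ (u.tsum_norm_coeff_le hk)
    refine (norm_tsum_le_tsum_norm ?_).trans_eq ?_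
    · simpa only [norm_fourier_smul] using u.summable_norm_coeff hk
    · simp only [norm_fourier_smul]

lemma evalCLM_apply (hk : 1 / 2 < k) (t : UnitAddCircle) (u : Sobolev V k) :
    evalCLM V hk t u = ∑' n, fourier n t • u.coeff n := rfl

end Sobolev

section LoopGroups

variable {d : ℕ} {G : Subgroup (GL (Fin d) ℂ)}

lemma exists_norm_le_of_isCompact (hG : IsCompact (G : Set (GL (Fin d) ℂ))) :
    ∃ C : ℝ, ∀ g : G, ‖((g : GL (Fin d) ℂ) : Matrix (Fin d) (Fin d) ℂ)‖ ≤ C := by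
  obtain ⟨C, hC⟩ := hG.exists_bound_of_continuousOn (E := Matrix (Fin d) (Fin d) ℂ)
    Units.continuous_val.continuousOn
  exact ⟨C, fun g => hC g g.2⟩

lemma isClosed_range_subgroup_val (hG : IsCompact (G : Set (GL (Fin d) ℂ))) :
    IsClosed (Set.range fun g : G => ((g : GL (Fin d) ℂ) : Matrix (Fin d) (Fin d) ℂ)) := by
  have : CompactSpace G := isCompact_iff_compactSpace.mp hG
  exact (isCompact_range continuous_subgroup_val).isClosed

namespace SmoothLoops

lemma continuous_loopMatrix (γ : SmoothLoops G) : Continuous (loopMatrix γ.1) := by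
  have h : ContDiff ℝ ∞ fun x : ℝ => loopMatrix γ.1 x := γ.2
  exact isQuotientMap_quotient_mk'.continuous_iff.mpr h.continuous

lemma coeff_toSobolev (s : ℝ) (γ : SmoothLoops G) :
    (toSobolev G s γ).coeff = fourierCoeff (loopMatrix γ.1) := rfl

lemma summable_norm_fourierCoeff (γ : SmoothLoops G) :
    Summable fun n => ‖fourierCoeff (loopMatrix γ.1) n‖ :=
  (toSobolev G 1 γ).summable_norm_coeff (by norm_num)

end SmoothLoops

lemma fourierCoeff_loopMatrix_mul {γ η : UnitAddCircle → G} (hγ : Continuous (loopMatrix γ))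
    (hη : Continuous (loopMatrix η)) (hγs : Summable fun n => ‖fourierCoeff (loopMatrix γ) n‖)
    (hηs : Summable fun n => ‖fourierCoeff (loopMatrix η) n‖) :
    fourierCoeff (loopMatrix (γ * η)) =
      conv (fourierCoeff (loopMatrix γ)) (fourierCoeff (loopMatrix η)) :=
  fourierCoeff_mul hγ hη hγs hηs

lemma loopMatrix_injective : Function.Injective (loopMatrix (G := G)) := fun _ _ h =>
  funext fun t => Subtype.ext (Units.ext (congrFun h t))

namespace SobolevLoops

lemma coeff_injective {s : ℝ} : Function.Injective (coeff (G := G) (s := s)) := fun _ _ h =>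
  Subtype.ext (Sobolev.ext h)

lemma coeff_ofSmooth (s : ℝ) (γ : SmoothLoops G) :
    (ofSmooth G s γ).coeff = fourierCoeff (loopMatrix γ.1) := rfl

lemma denseRange_ofSmooth (s : ℝ) : DenseRange (ofSmooth G s) := by
  have h : Topology.IsInducing (Subtype.val : sobolevLoopSet G s → _) := .subtypeVal
  intro a
  change a ∈ closure (Set.range fun γ => (⟨_, _⟩ : sobolevLoopSet G s))
  rw [h.closure_eq_preimage_closure_image, ← Set.range_comp]
  exact a.2

lemma summable_norm_coeff {k : ℝ} (hk : 1 / 2 < k) (a : SobolevLoops G k) :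
    Summable fun n => ‖a.coeff n‖ :=
  Sobolev.summable_norm_coeff hk a.1

/-- Having its value at t in the closed set G is a closed condition on H^k that smooth loops
satisfy, so it passes to their closure. -/
lemma exists_continuous_loop (hG : IsCompact (G : Set (GL (Fin d) ℂ))) {k : ℝ} (hk : 1 / 2 < k)
    (a : SobolevLoops G k) : ∃ γ : UnitAddCircle → G,
      Continuous (loopMatrix γ) ∧ a.coeff = fourierCoeff (loopMatrix γ) := by
  have h : ∀ t, Sobolev.evalCLM _ hk t a.1 ∈
      Set.range fun g : G => ((g : GL (Fin d) ℂ) : Matrix (Fin d) (Fin d) ℂ) := fun t => by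
    refine closure_minimal ?_
      ((isClosed_range_subgroup_val hG).preimage (Sobolev.evalCLM _ hk t).continuous) a.2
    rintro _ ⟨γ, rfl⟩
    refine ⟨γ.1 t, ?_⟩
    rw [Sobolev.evalCLM_apply, SmoothLoops.coeff_toSobolev,
      fourierSeries_fourierCoeff (SmoothLoops.continuous_loopMatrix γ) (SmoothLoops.summable_norm_fourierCoeff γ)]
    rfl
  choose γ hγ using h
  have e : loopMatrix γ = fun t => ∑' n, fourier n t • a.coeff n := funext hγ
  refine ⟨γ, ?_, ?_⟩
  · rw [e]
    exact continuous_fourierSeries (a.summable_norm_coeff hk)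
  · rw [e]
    exact (fourierCoeff_fourierSeries (a.summable_norm_coeff hk)).symm

/-- The inclusion of `H^t(S^1, G)` into `H^s(S^1, G)`, `s ≤ t`. -/
def restrictIndex {s t : ℝ} (h : s ≤ t) (a : SobolevLoops G t) : SobolevLoops G s :=
  ⟨Sobolev.inclusion _ h a.1, map_mem_closure (Sobolev.inclusion _ h).continuous a.2 (by
    rintro _ ⟨γ, rfl⟩
    exact ⟨γ, Sobolev.ext (by
      rw [Sobolev.coeff_inclusion, SmoothLoops.coeff_toSobolev, SmoothLoops.coeff_toSobolev])⟩)⟩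

lemma coeff_restrictIndex {s t : ℝ} (h : s ≤ t) (a : SobolevLoops G t) :
    (a.restrictIndex h).coeff = a.coeff := Sobolev.coeff_inclusion h a.1

end SobolevLoops

lemma abs_self_le_of_half_lt {k : ℝ} (hk : 1 / 2 < k) : |k| ≤ k := (abs_of_pos (by linarith)).le

lemma mul_mem_sobolevLoopSet {k : ℝ} (hk : 1 / 2 < k)
    {a b : Sobolev (Matrix (Fin d) (Fin d) ℂ) k} (ha : a ∈ sobolevLoopSet G k)
    (hb : b ∈ sobolevLoopSet G k) :
    Sobolev.mul hk (abs_self_le_of_half_lt hk) a b ∈ sobolevLoopSet G k := by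
  refine map_mem_closure₂ (f := fun a b => Sobolev.mul hk (abs_self_le_of_half_lt hk) a b)
    (by fun_prop) ha hb ?_
  rintro _ ⟨γ, rfl⟩ _ ⟨η, rfl⟩
  refine ⟨γ * η, Sobolev.ext ?_⟩
  rw [Sobolev.coeff_mul]
  exact fourierCoeff_loopMatrix_mul (SmoothLoops.continuous_loopMatrix γ) (SmoothLoops.continuous_loopMatrix η)
    (SmoothLoops.summable_norm_fourierCoeff γ) (SmoothLoops.summable_norm_fourierCoeff η)

lemma exists_coeff_eq_fourierCoeff_inv (hG : IsCompact (G : Set (GL (Fin d) ℂ))) {k : ℝ}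
    {γ : UnitAddCircle → G} (hγ : Continuous (loopMatrix γ)) {a : SobolevLoops G k}
    (ha : a.coeff = fourierCoeff (loopMatrix γ)) :
    Continuous (loopMatrix γ⁻¹) ∧
      ∃ b : SobolevLoops G k, b.coeff = fourierCoeff (loopMatrix γ⁻¹) := by
  obtain ⟨P, Q, h⟩ := exists_inv_eq_mul_conjTranspose_mul hG
  have e : ∀ γ : UnitAddCircle → G,
      loopMatrix γ⁻¹ = fun t => P * (loopMatrix γ t).conjTranspose * Q :=
    fun γ => funext fun t => h (γ t)
  refine ⟨?_, ⟨Sobolev.mulConjTransposeMul P Q a.1,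
    map_mem_closure (Sobolev.continuous_mulConjTransposeMul P Q) a.2 ?_⟩, ?_⟩
  · rw [e]
    exact (continuous_const.mul hγ.matrix_conjTranspose).mul continuous_const
  · rintro _ ⟨γ, rfl⟩
    refine ⟨γ⁻¹, Sobolev.ext (funext fun n => ?_)⟩
    rw [Sobolev.coeff_mulConjTransposeMul, SmoothLoops.coeff_toSobolev,
      SmoothLoops.coeff_toSobolev]
    refine Eq.trans ?_
      (fourierCoeff_mul_conjTranspose_mul P Q (SmoothLoops.continuous_loopMatrix γ) n)
    rw [← e]
    rfl
  · funext n
    rw [e, fourierCoeff_mul_conjTranspose_mul P Q hγ, ← ha]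
    rfl

/-- The continuous loops in `G` whose Fourier coefficients are those of an element of
`H^k(S^1, G)`. -/
def sobolevLoopSubgroup (hG : IsCompact (G : Set (GL (Fin d) ℂ))) {k : ℝ} (hk : 1 / 2 < k) :
    Subgroup (UnitAddCircle → G) where
  carrier := {γ | Continuous (loopMatrix γ) ∧
    ∃ a : SobolevLoops G k, a.coeff = fourierCoeff (loopMatrix γ)}
  mul_mem' := by
    rintro γ η ⟨hγ, a, ha⟩ ⟨hη, b, hb⟩
    refine ⟨hγ.mul hη, ⟨_, mul_mem_sobolevLoopSet hk a.2 b.2⟩, ?_⟩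
    rw [fourierCoeff_loopMatrix_mul hγ hη (ha ▸ a.summable_norm_coeff hk)
      (hb ▸ b.summable_norm_coeff hk), ← ha, ← hb]
    exact Sobolev.coeff_mul _ _ _ _
  one_mem' := ⟨continuous_const, SobolevLoops.ofSmooth G k 1, rfl⟩
  inv_mem' := by
    rintro γ ⟨hγ, a, ha⟩
    exact exists_coeff_eq_fourierCoeff_inv hG hγ ha

/-- The continuous loops in `G` whose Fourier coefficients are those of an element of
`H^{1/2,+}(S^1, G)`. -/
def sobolevLoopPlusSubgroup (hG : IsCompact (G : Set (GL (Fin d) ℂ))) :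
    Subgroup (UnitAddCircle → G) where
  carrier := {γ | ∃ (k : ℝ) (hk : 1 / 2 < k), γ ∈ sobolevLoopSubgroup hG hk}
  mul_mem' := by
    rintro γ η ⟨k, hk, hγ, a, ha⟩ ⟨l, hl, hη, b, hb⟩
    -- Both factors lie in the space of the smaller index, which still exceeds 1/2.
    exact ⟨min k l, lt_min hk hl, mul_mem
      ⟨hγ, a.restrictIndex (min_le_left k l), (a.coeff_restrictIndex _).trans ha⟩
      ⟨hη, b.restrictIndex (min_le_right k l), (b.coeff_restrictIndex _).trans hb⟩⟩
  one_mem' := ⟨1, by norm_num, one_mem _⟩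
  inv_mem' := by
    rintro γ ⟨k, hk, hγ⟩
    exact ⟨k, hk, inv_mem hγ⟩

/-- A space of loops given by Fourier coefficients, whose elements correspond to the elements of a
group of continuous loops, is a group under pointwise multiplication. -/
lemma exists_isPointwiseLoopGroup {X : Type*} {coeff : X → ℤ → Matrix (Fin d) (Fin d) ℂ}
    (hcoeff : Function.Injective coeff) (K : Subgroup (UnitAddCircle → G))
    (hK : ∀ γ ∈ K, Continuous (loopMatrix γ) ∧ ∃ a, coeff a = fourierCoeff (loopMatrix γ))
    (hX : ∀ a, (Summable fun n => ‖coeff a n‖) ∧ ∃ γ ∈ K, coeff a = fourierCoeff (loopMatrix γ)) :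
    ∃ _ : Group X, IsPointwiseLoopGroup (G := G) coeff := by
  choose f hf using fun γ : K => (hK γ.1 γ.2).2
  have hbij : Function.Bijective f := by
    constructor
    · intro γ η h
      have h' : fourierCoeff (loopMatrix γ.1) = fourierCoeff (loopMatrix η.1) := by
        rw [← hf, ← hf, h]
      exact Subtype.ext (loopMatrix_injective (eq_of_fourierCoeff_eq (hK γ.1 γ.2).1 (hK η.1 η.2).1
        (hf γ ▸ (hX (f γ)).1) h'))
    · intro a
      obtain ⟨γ, hγ, ha⟩ := (hX a).2
      exact ⟨⟨γ, hγ⟩, hcoeff ((hf _).trans ha.symm)⟩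
  let e : X ≃ K := (Equiv.ofBijective f hbij).symm
  let _ : Group X := e.group
  refine ⟨inferInstance, K.subtype.comp (e.mulEquiv : X ≃* K).toMonoidHom, fun a => ?_⟩
  refine ⟨(hK _ (e a).2).1, ?_⟩
  have h := hf (e a)
  rwa [show f (e a) = a from (Equiv.ofBijective f hbij).apply_symm_apply a] at h

end LoopGroups

/-! ### Plots of `H^s(S^1, G)` -/

namespace SobolevLoops

open Diffeology

variable {d : ℕ} {G : Subgroup (GL (Fin d) ℂ)} {s : ℝ} {m : ℕ}

lemma isPlot_of_contDiff {q : EuclideanSpace ℝ (Fin m) → SobolevLoops G s}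
    (hq : ContDiff ℝ ∞ fun x => (q x).1) : IsPlot q :=
  fun _ hf => hf m q hq

/-- Real and imaginary parts of continuous functionals are smooth functions for the trace
diffeology, so plots of its completion are scalarwise smooth. -/
lemma contDiff_of_isPlot {q : EuclideanSpace ℝ (Fin m) → SobolevLoops G s} (hq : IsPlot q) :
    ContDiff ℝ ∞ fun x => (q x).1 := by
  refine contDiff_of_forall_dual fun l => ?_
  have hl (L : ℂ →L[ℝ] ℝ) : ContDiff ℝ ∞ fun x => L (l (q x).1) :=
    hq (fun a => L (l a.1)) fun n p hp =>
      L.contDiff.comp ((l.restrictScalars ℝ).contDiff.comp hp)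
  have e : (fun x => l (q x).1) = fun x =>
      Complex.equivRealProdCLM.symm (Complex.reCLM (l (q x).1), Complex.imCLM (l (q x).1)) :=
    funext fun x => (Complex.equivRealProdCLM.symm_apply_apply _).symm
  rw [e]
  exact Complex.equivRealProdCLM.symm.contDiff.comp ((hl _).prodMk (hl _))

end SobolevLoops

/-! ### Bounded loops in negative Sobolev spaces -/

section Lift

open scoped ENNReal

lemma sobolevSqNorm_sub_le {V : Type*} [NormedAddCommGroup V] (s : ℝ) (c c' : ℤ → V) :
    sobolevSqNorm s (fun n => c n - c' n) ≤ 3 * (sobolevSqNorm s c + sobolevSqNorm s c') := by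
  unfold sobolevSqNorm
  rw [← ENNReal.tsum_add, ← ENNReal.tsum_mul_left]
  refine ENNReal.tsum_le_tsum fun n => ?_
  have h := ENNReal.add_add_sq_le (ENNReal.ofReal (sobolevWeight s n) * ‖c n‖ₑ)
    (ENNReal.ofReal (sobolevWeight s n) * ‖c' n‖ₑ) 0
  rw [add_zero, ← mul_add, zero_pow two_ne_zero, add_zero] at h
  refine le_trans ?_ h
  gcongr
  exact enorm_sub_le

namespace Sobolev

variable {V : Type*} [NormedAddCommGroup V] [NormedSpace ℂ V] {s σ σ' : ℝ}

/-- Lower semicontinuity: the norm is a supremum of finite sums that are continuous on H^s, also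
when σ > s. -/
lemma isClosed_setOf_sobolevSqNorm_le (C : ℝ≥0∞) :
    IsClosed {u : Sobolev V s | sobolevSqNorm σ u.coeff ≤ C} := by
  simp only [sobolevSqNorm, ENNReal.tsum_eq_iSup_sum, iSup_le_iff, Set.ofPred_forall]
  refine isClosed_iInter fun F => isClosed_le ?_ continuous_const
  refine continuous_finsetSum _ fun n _ => (ENNReal.continuous_pow 2).comp ?_
  exact (ENNReal.continuous_const_mul ENNReal.ofReal_ne_top).comp (coeffCLM V s n).continuous.enorm

lemma norm_sq_le_interpolate (h₁ : s < σ) (h₂ : σ < σ') {u : Sobolev V σ} {v : Sobolev V s}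
    (huv : u.coeff = v.coeff) {D : ℝ} (hD : 0 ≤ D)
    (hu : sobolevSqNorm σ' u.coeff ≤ ENNReal.ofReal D) {τ : ℝ} (hτ : 1 ≤ τ) :
    ‖u‖ ^ 2 ≤ τ ^ (-(2 * (σ' - σ))) * D + τ ^ (2 * (σ - s)) * ‖v‖ ^ 2 := by
  have hτ0 : 0 < τ := by linarith
  rw [← ENNReal.ofReal_le_ofReal_iff (by positivity), ENNReal.ofReal_add (by positivity)
    (by positivity), ENNReal.ofReal_mul (by positivity), ENNReal.ofReal_mul (by positivity),
    ofReal_norm_sq, ofReal_norm_sq, ← huv]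
  refine (sobolevSqNorm_interpolate h₁ h₂ hτ u.coeff).trans ?_
  gcongr

open scoped FourierTransform

lemma pow_mul_norm_inclusion_le (h₁ : s < σ) (h₂ : σ < σ') (N : ℕ) :
    ∃ L : ℕ, ∀ (u : Sobolev V σ') (x B C : ℝ), 1 ≤ x → 0 ≤ B → ‖u‖ ≤ B →
      x ^ L * ‖inclusion V (h₁.trans h₂).le u‖ ≤ C →
        x ^ N * ‖inclusion V h₂.le u‖ ≤ √(B ^ 2 + C ^ 2) := by
  set p := 2 * (σ' - σ)
  set r := 2 * (σ - s)
  have hp : 0 < p := by simp only [p]; linarith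
  have hr : 0 < r := by simp only [r]; linarith
  obtain ⟨L, hL⟩ := exists_nat_gt (N * r / p + N)
  refine ⟨L, fun u x B C hx hB hu hC => Real.le_sqrt_of_sq_le ?_⟩
  have hx0 : 0 < x := by linarith
  -- With τ = x^(2N/p), the factor τ^(-p) cancels x^(2N), and x^(2N) τ^r is at most x^(2L) by the
  -- choice of L.
  have key := norm_sq_le_interpolate h₁ h₂ (u := inclusion V h₂.le u)
    (v := inclusion V (h₁.trans h₂).le u) (by rw [coeff_inclusion, coeff_inclusion])
    (sq_nonneg B) (by
      rw [coeff_inclusion, ← ofReal_norm_sq]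
      exact ENNReal.ofReal_le_ofReal (pow_le_pow_left₀ (norm_nonneg _) hu 2))
    (τ := x ^ (2 * N / p)) (Real.one_le_rpow hx (by positivity))
  rw [← Real.rpow_mul hx0.le, ← Real.rpow_mul hx0.le] at key
  have hsq (j : ℕ) : (x ^ j) ^ 2 = x ^ (2 * (j : ℝ)) := by
    rw [← pow_mul, ← Real.rpow_natCast]; push_cast; ring_nf
  have e₁ : 2 * (N : ℝ) + 2 * N / p * -p = 0 := by field_simp; ring
  have e₂ : 2 * (N : ℝ) + 2 * N / p * r ≤ 2 * L := by
    calc 2 * (N : ℝ) + 2 * N / p * r = 2 * (N * r / p + N) := by ring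
      _ ≤ 2 * L := by linarith
  generalize ‖inclusion V h₂.le u‖ = a at *
  generalize hb : ‖inclusion V (h₁.trans h₂).le u‖ = b at *
  have hb0 : 0 ≤ b := hb ▸ norm_nonneg _
  calc (x ^ N * a) ^ 2 = x ^ (2 * (N : ℝ)) * a ^ 2 := by rw [mul_pow, hsq]
    _ ≤ x ^ (2 * (N : ℝ)) * (x ^ (2 * N / p * -p) * B ^ 2 + x ^ (2 * N / p * r) * b ^ 2) := by
        gcongr
    _ = B ^ 2 + x ^ (2 * N + 2 * N / p * r) * b ^ 2 := by
        rw [mul_add, ← mul_assoc, ← mul_assoc, ← Real.rpow_add hx0, ← Real.rpow_add hx0, e₁,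
          Real.rpow_zero, one_mul]
    _ ≤ B ^ 2 + x ^ (2 * (L : ℝ)) * b ^ 2 := by gcongr
    _ = B ^ 2 + (x ^ L * b) ^ 2 := by rw [mul_pow, hsq]
    _ ≤ B ^ 2 + C ^ 2 := by gcongr

variable [CompleteSpace V] {W : Type*} [NormedAddCommGroup W] [InnerProductSpace ℝ W]
  [FiniteDimensional ℝ W] [MeasurableSpace W] [BorelSpace W]

/-- A continuous map into `H^σ'` which is smooth as a map into `H^s` is smooth as a map into `H^σ`
for `s < σ < σ'`. -/
theorem contDiff_inclusion_of_contDiff_inclusion (h₁ : s < σ) (h₂ : σ < σ') {q : W → Sobolev V σ'}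
    (hq : Continuous q) (hqs : ContDiff ℝ ∞ fun x => inclusion V (h₁.trans h₂).le (q x)) :
    ContDiff ℝ ∞ fun x => inclusion V h₂.le (q x) := by
  refine contDiff_of_contDiff_smul fun χ hχ hχc => ?_
  have hf : Continuous fun x => χ x • q x := hχ.continuous.smul hq
  have hfi := hf.integrable_of_hasCompactSupport (μ := MeasureTheory.volume) hχc.smul_right
  have hF : ∀ {r : ℝ} (h : r ≤ σ') (ξ : W), 𝓕 (fun x => χ x • inclusion V h (q x)) ξ =
      inclusion V h (𝓕 (fun x => χ x • q x) ξ) := fun h ξ => by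
    rw [(inclusion V h).fourier_comp_comm hfi]
    congr 1
  -- In H^σ' the transform is merely bounded, in H^s it decays rapidly; interpolation transfers
  -- rapid decay to H^σ.
  have hB : ∀ ξ, ‖𝓕 (fun x => χ x • q x) ξ‖ ≤ ∫ x, ‖χ x • q x‖ :=
    fun ξ => VectorFourier.norm_fourierIntegral_le_integral_norm _ _ _ _ _
  have hB0 : 0 ≤ ∫ x, ‖χ x • q x‖ := MeasureTheory.integral_nonneg fun _ => norm_nonneg _
  refine contDiff_of_fourier_decay (hχ.continuous.smul ((inclusion V h₂.le).continuous.comp hq))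
    hχc.smul_right fun N => ?_
  obtain ⟨L, hL⟩ := pow_mul_norm_inclusion_le (V := V) h₁ h₂ N
  obtain ⟨C, hC⟩ := exists_pow_mul_norm_fourier_le (hχ.smul hqs) hχc.smul_right L
  refine ⟨max (‖inclusion V h₂.le‖ * ∫ x, ‖χ x • q x‖) √((∫ x, ‖χ x • q x‖) ^ 2 + C ^ 2),
    fun ξ => ?_⟩
  rw [hF]
  rcases le_total ‖ξ‖ 1 with hξ | hξ
  · refine le_max_of_le_left ?_
    calc _ ≤ 1 * (‖inclusion V h₂.le‖ * ‖𝓕 (fun x => χ x • q x) ξ‖) := by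
          gcongr
          · exact pow_le_one₀ (norm_nonneg _) hξ
          · exact ContinuousLinearMap.le_opNorm _ _
      _ ≤ _ := by rw [one_mul]; gcongr; exact hB ξ
  · refine le_max_of_le_right (hL _ _ _ _ hξ hB0 (hB ξ) ?_)
    rw [← hF]
    exact hC ξ

end Sobolev

/-- Choosing τ = δ^(-1/r) at distance δ ≤ 1 bounds the square by δ^(p/r) D + δ, which tends to 0. -/
lemma continuous_of_norm_sub_sq_le_interpolate {X E : Type*} [MetricSpace X]
    [NormedAddCommGroup E] {f : X → E} {D p r : ℝ} (hD0 : 0 ≤ D) (hp : 0 < p) (hr : 0 < r)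
    (hD : ∀ (a b : X) (τ : ℝ), 1 ≤ τ → ‖f a - f b‖ ^ 2 ≤ τ ^ (-p) * D + τ ^ r * dist a b ^ 2) :
    Continuous f := by
  refine continuous_iff_continuousAt.mpr fun b => ?_
  rw [ContinuousAt, tendsto_iff_norm_sub_tendsto_zero]
  have hlim : Filter.Tendsto (fun a => √(dist a b ^ (p / r) * D + dist a b)) (nhds b) (nhds 0) := by
    have : Continuous fun a : X => √(dist a b ^ (p / r) * D + dist a b) := by
      have h1 : Continuous fun a : X => dist a b := by fun_prop
      exact (((h1.rpow_const fun _ => .inr (by positivity)).mul continuous_const).add h1).sqrt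
    have h0 := this.tendsto b
    rwa [dist_self, Real.zero_rpow (by positivity), zero_mul, zero_add, Real.sqrt_zero] at h0
  refine squeeze_zero' (.of_forall fun _ => norm_nonneg _) ?_ hlim
  filter_upwards [Metric.closedBall_mem_nhds b one_pos] with a ha
  refine Real.le_sqrt_of_sq_le ?_
  rcases (dist_nonneg (x := a) (y := b)).eq_or_lt with h0 | h0
  · rw [dist_eq_zero.mp h0.symm, sub_self, norm_zero, zero_pow two_ne_zero]
    positivity
  · have ha1 : dist a b ≤ 1 := ha
    refine (hD a b (dist a b ^ (-r⁻¹))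
      (Real.one_le_rpow_of_pos_of_le_one_of_nonpos h0 ha1 (by simpa using hr.le))).trans_eq ?_
    rw [← Real.rpow_mul h0.le, ← Real.rpow_mul h0.le, ← Real.rpow_natCast (dist a b) 2,
      ← Real.rpow_add h0, show -r⁻¹ * -p = p / r by ring,
      show -r⁻¹ * r + ((2 : ℕ) : ℝ) = 1 by push_cast; field_simp; norm_num, Real.rpow_one]

variable {d : ℕ} {G : Subgroup (GL (Fin d) ℂ)} {s σ : ℝ}

/-- Smooth loops in the compact G are uniformly bounded in sup norm, hence in H^0; the bound defines
a closed subset of H^s for every s. -/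
lemma exists_sobolevSqNorm_zero_le (hG : IsCompact (G : Set (GL (Fin d) ℂ))) :
    ∃ C : ℝ, 0 ≤ C ∧ ∀ (s : ℝ) (a : SobolevLoops G s),
      sobolevSqNorm 0 a.coeff ≤ ENNReal.ofReal C := by
  obtain ⟨C, hC⟩ := exists_norm_le_of_isCompact hG
  refine ⟨d * (d * C ^ 2), by positivity, fun s a => ?_⟩
  refine closure_minimal ?_ (Sobolev.isClosed_setOf_sobolevSqNorm_le _) a.2
  rintro _ ⟨γ, rfl⟩
  refine (sobolevSqNorm_zero_fourierCoeff_le (SmoothLoops.continuous_loopMatrix γ)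
    fun t => hC (γ.1 t)).trans_eq ?_
  rw [ENNReal.ofReal_mul (by positivity), ENNReal.ofReal_mul (by positivity),
    ENNReal.ofReal_natCast]

namespace SobolevLoops

/-- An element of `H^s(S^1, G)`, being the Fourier transform of a square integrable function, as an
element of `H^σ(S^1, M)`, `σ ≤ 0`. -/
def lift (hG : IsCompact (G : Set (GL (Fin d) ℂ))) (hσ : σ ≤ 0) (a : SobolevLoops G s) :
    Sobolev (Matrix (Fin d) (Fin d) ℂ) σ :=
  Sobolev.mk σ a.coeff (by
    obtain ⟨C, -, hC⟩ := exists_sobolevSqNorm_zero_le hG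
    exact ne_top_of_le_ne_top ENNReal.ofReal_ne_top ((sobolevSqNorm_mono hσ _).trans (hC s a)))

lemma coeff_lift (hG : IsCompact (G : Set (GL (Fin d) ℂ))) (hσ : σ ≤ 0) (a : SobolevLoops G s) :
    (a.lift hG hσ).coeff = a.coeff := Sobolev.coeff_mk _ _

lemma exists_norm_lift_sub_sq_le (hG : IsCompact (G : Set (GL (Fin d) ℂ))) (h : s < σ)
    (hσ : σ < 0) : ∃ D : ℝ, 0 ≤ D ∧ ∀ (a b : SobolevLoops G s) (τ : ℝ), 1 ≤ τ →
      ‖a.lift hG hσ.le - b.lift hG hσ.le‖ ^ 2 ≤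
        τ ^ (-(2 * (0 - σ))) * D + τ ^ (2 * (σ - s)) * dist a b ^ 2 := by
  obtain ⟨C, hC0, hC⟩ := exists_sobolevSqNorm_zero_le hG
  refine ⟨3 * (C + C), by positivity, fun a b τ hτ => ?_⟩
  have hd : dist a b = ‖a.1 - b.1‖ := dist_eq_norm a.1 b.1
  have e : (a.lift hG hσ.le - b.lift hG hσ.le).coeff = fun n => a.coeff n - b.coeff n := by
    funext n
    rw [Sobolev.coeff_sub, coeff_lift, coeff_lift]
  rw [hd]
  refine Sobolev.norm_sq_le_interpolate h hσ (e.trans rfl) (by positivity) ?_ hτ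
  rw [e]
  refine (sobolevSqNorm_sub_le _ _ _).trans ?_
  rw [ENNReal.ofReal_mul (by positivity), ENNReal.ofReal_add hC0 hC0]
  gcongr
  · norm_num
  · exact hC s a
  · exact hC s b

lemma continuous_lift (hG : IsCompact (G : Set (GL (Fin d) ℂ))) (h : s < σ) (hσ : σ < 0) :
    Continuous (lift (G := G) (s := s) hG hσ.le) := by
  obtain ⟨D, hD0, hD⟩ := exists_norm_lift_sub_sq_le (G := G) hG h hσ
  exact continuous_of_norm_sub_sq_le_interpolate hD0 (by linarith) (by linarith) hD

lemma contDiff_lift_of_isPlot (hG : IsCompact (G : Set (GL (Fin d) ℂ))) (h : s < σ) (hσ : σ < 0)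
    {m : ℕ} {q : EuclideanSpace ℝ (Fin m) → SobolevLoops G s} (hq : Diffeology.IsPlot q) :
    ContDiff ℝ ∞ fun x => (q x).lift hG hσ.le := by
  have hq0 : ContDiff ℝ ∞ fun x => (q x).1 := contDiff_of_isPlot hq
  have hqc : Continuous q := continuous_induced_rng.mpr hq0.continuous
  -- The index σ/2 leaves room for interpolation: the plot is continuous into H^(σ/2) and smooth
  -- into H^s, hence smooth into H^σ.
  have hσ2 : σ < σ / 2 := by linarith
  have hσ2' : σ / 2 < 0 := by linarith
  have e₀ : (fun x => (q x).1) = fun x =>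
      Sobolev.inclusion _ (h.trans hσ2).le ((q x).lift hG hσ2'.le) := funext fun x =>
    Sobolev.ext (by rw [Sobolev.coeff_inclusion, coeff_lift]; rfl)
  have e₁ : (fun x => (q x).lift hG hσ.le) = fun x =>
      Sobolev.inclusion _ hσ2.le ((q x).lift hG hσ2'.le) := funext fun x =>
    Sobolev.ext (by rw [Sobolev.coeff_inclusion, coeff_lift, coeff_lift])
  rw [e₁]
  rw [e₀] at hq0
  exact Sobolev.contDiff_inclusion_of_contDiff_inclusion h hσ2
    ((continuous_lift hG (h.trans hσ2) hσ2').comp hqc) hq0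

end SobolevLoops

end Lift

/-! ### The action on `H^s(S^1, G)` -/

section Action

variable {d : ℕ} {G : Subgroup (GL (Fin d) ℂ)}

/-- Associativity is read off from pointwise multiplication of loops. -/
lemma conv_conv_fourierCoeff {α β γ : UnitAddCircle → G} (hα : Continuous (loopMatrix α))
    (hβ : Continuous (loopMatrix β)) (hγ : Continuous (loopMatrix γ))
    (hαs : Summable fun n => ‖fourierCoeff (loopMatrix α) n‖)
    (hβs : Summable fun n => ‖fourierCoeff (loopMatrix β) n‖)
    (hγs : Summable fun n => ‖fourierCoeff (loopMatrix γ) n‖) :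
    conv (fourierCoeff (loopMatrix (α * β))) (fourierCoeff (loopMatrix γ)) =
      conv (fourierCoeff (loopMatrix α))
        (conv (fourierCoeff (loopMatrix β)) (fourierCoeff (loopMatrix γ))) := by
  have h₁ : Summable fun n => ‖fourierCoeff (loopMatrix (α * β)) n‖ := by
    rw [fourierCoeff_loopMatrix_mul hα hβ hαs hβs]
    exact summable_norm_conv hαs hβs
  have h₂ : Summable fun n => ‖fourierCoeff (loopMatrix (β * γ)) n‖ := by
    rw [fourierCoeff_loopMatrix_mul hβ hγ hβs hγs]
    exact summable_norm_conv hβs hγs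
  have hαβ : Continuous (loopMatrix (α * β)) := hα.mul hβ
  have hβγ : Continuous (loopMatrix (β * γ)) := hβ.mul hγ
  rw [← fourierCoeff_loopMatrix_mul hαβ hγ h₁ hγs, ← fourierCoeff_loopMatrix_mul hβ hγ hβs hγs,
    ← fourierCoeff_loopMatrix_mul hα hβγ hαs h₂, mul_assoc]

/-- `H^s(S^1, G)` embeds into `H^σ(S^1, M)` if `s = σ` or `s < σ < 0`. -/
lemma SobolevLoops.exists_lift (hG : IsCompact (G : Set (GL (Fin d) ℂ))) {s σ : ℝ}
    (h : s = σ ∨ s < σ ∧ σ < 0) :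
    ∃ Λ : SobolevLoops G s → Sobolev (Matrix (Fin d) (Fin d) ℂ) σ,
      (∀ a, (Λ a).coeff = a.coeff) ∧ Continuous Λ ∧
      ∀ (m : ℕ) (q : EuclideanSpace ℝ (Fin m) → SobolevLoops G s), Diffeology.IsPlot q →
        ContDiff ℝ ∞ fun x => Λ (q x) := by
  rcases h with rfl | ⟨h, hσ⟩
  · exact ⟨fun a => a.1, fun _ => rfl, continuous_subtype_val, fun m q hq => contDiff_of_isPlot hq⟩
  · exact ⟨lift hG hσ.le, coeff_lift hG hσ.le, continuous_lift hG h hσ,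
      fun m q hq => contDiff_lift_of_isPlot hG h hσ hq⟩

lemma inclusion_mem_sobolevLoopSet {X : Type*} [TopologicalSpace X] {s σ : ℝ} (hsσ : s ≤ σ)
    {i : SmoothLoops G → X} (hd : DenseRange i)
    {Λ : SobolevLoops G s → Sobolev (Matrix (Fin d) (Fin d) ℂ) σ} (hΛc : Continuous Λ)
    {T : X → Sobolev (Matrix (Fin d) (Fin d) ℂ) σ →L[ℂ] Sobolev (Matrix (Fin d) (Fin d) ℂ) σ}
    (hTc : Continuous T)
    (h : ∀ γ η, Sobolev.inclusion _ hsσ (T (i γ) (Λ (SobolevLoops.ofSmooth G s η))) =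
      SmoothLoops.toSobolev G s (γ * η)) (a : X) (u : SobolevLoops G s) :
    Sobolev.inclusion _ hsσ (T a (Λ u)) ∈ sobolevLoopSet G s := by
  have hc : Continuous fun p : X × SobolevLoops G s => Sobolev.inclusion _ hsσ (T p.1 (Λ p.2)) :=
    (Sobolev.inclusion _ hsσ).continuous.comp
      ((hTc.comp continuous_fst).clm_apply (hΛc.comp continuous_snd))
  refine map_mem_closure (f := fun p : X × SobolevLoops G s =>
    Sobolev.inclusion _ hsσ (T p.1 (Λ p.2))) hc ((hd.prodMap (SobolevLoops.denseRange_ofSmooth s)) (a, u)) ?_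
  rintro _ ⟨⟨γ, η⟩, rfl⟩
  exact ⟨γ * η, (h γ η).symm⟩

namespace SobolevLoops

variable {k s : ℝ}

/-- Multiplication by an element of `H^k(S^1, G)`, as an operator on `H^s(S^1, M)`. -/
def mulCLM (hk : 1 / 2 < k) (hs : |s| ≤ k) (a : SobolevLoops G k) :
    Sobolev (Matrix (Fin d) (Fin d) ℂ) s →L[ℂ] Sobolev (Matrix (Fin d) (Fin d) ℂ) s :=
  Sobolev.mul hk hs a.1

lemma coeff_mulCLM (hk : 1 / 2 < k) (hs : |s| ≤ k) (a : SobolevLoops G k)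
    (u : Sobolev (Matrix (Fin d) (Fin d) ℂ) s) :
    (a.mulCLM hk hs u).coeff = conv a.coeff u.coeff :=
  Sobolev.coeff_mul hk hs a.1 u

lemma continuous_mulCLM (hk : 1 / 2 < k) (hs : |s| ≤ k) :
    Continuous (mulCLM (G := G) hk hs) :=
  (Sobolev.mul hk hs).continuous.comp continuous_subtype_val

lemma contDiff_mulCLM_of_isPlot (hk : 1 / 2 < k) (hs : |s| ≤ k) {m : ℕ}
    {q : EuclideanSpace ℝ (Fin m) → SobolevLoops G k} (hq : Diffeology.IsPlot q) :
    ContDiff ℝ ∞ fun x => (q x).mulCLM hk hs :=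
  ((Sobolev.mul hk hs).contDiff.restrict_scalars ℝ).comp (contDiff_of_isPlot hq)

end SobolevLoops

/-- A group `X` of loops acting on `H^σ(S^1, M)` by multiplication, continuously in the operator
norm and smoothly along plots, acts continuously and smoothly on `H^s(S^1, G)`. -/
theorem exists_isSmoothExtensionOfLoopMul {X : Type*} [Group X] [TopologicalSpace X]
    [DiffeologicalSpace X] {coeff : X → ℤ → Matrix (Fin d) (Fin d) ℂ}
    (hX : IsPointwiseLoopGroup (G := G) coeff) (hsum : ∀ a, Summable fun n => ‖coeff a n‖)
    {i : SmoothLoops G → X} (hi : ∀ γ, coeff (i γ) = fourierCoeff (loopMatrix γ.1))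
    (hd : DenseRange i) {s σ : ℝ} (hsσ : s ≤ σ)
    {Λ : SobolevLoops G s → Sobolev (Matrix (Fin d) (Fin d) ℂ) σ}
    (hΛ : ∀ a, (Λ a).coeff = a.coeff) (hΛc : Continuous Λ)
    (hΛs : ∀ (m : ℕ) (q : EuclideanSpace ℝ (Fin m) → SobolevLoops G s), Diffeology.IsPlot q →
        ContDiff ℝ ∞ fun x => Λ (q x))
    {T : X → Sobolev (Matrix (Fin d) (Fin d) ℂ) σ →L[ℂ] Sobolev (Matrix (Fin d) (Fin d) ℂ) σ}
    (hT : ∀ a u, (T a u).coeff = conv (coeff a) u.coeff) (hTc : Continuous T)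
    (hTs : ∀ (m : ℕ) (p : EuclideanSpace ℝ (Fin m) → X), Diffeology.IsPlot p →
        ContDiff ℝ ∞ fun x => T (p x)) :
    ∃ _ : MulAction X (SobolevLoops G s),
      IsSmoothExtensionOfLoopMul G i (SobolevLoops.ofSmooth G s) := by
  obtain ⟨ev, hev⟩ := hX
  have hevs (a : X) : Summable fun n => ‖fourierCoeff (loopMatrix (ev a)) n‖ := by
    rw [← (hev a).2]
    exact hsum a
  have hsmooth (γ η : SmoothLoops G) :
      Sobolev.inclusion _ hsσ (T (i γ) (Λ (SobolevLoops.ofSmooth G s η))) =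
        SmoothLoops.toSobolev G s (γ * η) := Sobolev.ext (by
    rw [Sobolev.coeff_inclusion, hT, hΛ, hi, SobolevLoops.coeff_ofSmooth,
      SmoothLoops.coeff_toSobolev]
    exact (fourierCoeff_loopMatrix_mul (SmoothLoops.continuous_loopMatrix γ)
      (SmoothLoops.continuous_loopMatrix η) (SmoothLoops.summable_norm_fourierCoeff γ)
      (SmoothLoops.summable_norm_fourierCoeff η)).symm)
  have hmem := inclusion_mem_sobolevLoopSet hsσ hd hΛc hTc hsmooth
  let act (a : X) (u : SobolevLoops G s) : SobolevLoops G s := ⟨_, hmem a u⟩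
  have hact (a : X) (u : SobolevLoops G s) : (act a u).coeff = conv (coeff a) u.coeff := by
    rw [← hΛ u, ← hT]
    exact Sobolev.coeff_inclusion _ _
  -- Passing down to H^s loses nothing: lifting the result recovers the product in H^σ.
  have hΛact (a : X) (u : SobolevLoops G s) : Λ (act a u) = T a (Λ u) :=
    Sobolev.ext (by rw [hΛ, hact, hT, hΛ])
  have hcont : Continuous fun p : X × SobolevLoops G s => act p.1 p.2 :=
    continuous_induced_rng.mpr ((Sobolev.inclusion _ hsσ).continuous.comp
      ((hTc.comp continuous_fst).clm_apply (hΛc.comp continuous_snd)))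
  have hcont' (a : X) : Continuous (act a) := hcont.comp (Continuous.prodMk_right a)
  let inst : MulAction X (SobolevLoops G s) :=
    { smul := act
      -- Both action axioms are closed conditions on u, so smooth u suffice, where they concern
      -- products of continuous loops.
      one_smul := fun u => by
        refine congrFun ((SobolevLoops.denseRange_ofSmooth s).equalizer (hcont' 1) continuous_id
          (funext fun η => SobolevLoops.coeff_injective ?_)) u
        change (act 1 _).coeff = _
        have h1 : coeff 1 = fourierCoeff (loopMatrix (1 : SmoothLoops G).1) := by
          rw [(hev 1).2, map_one]
          rfl
        rw [hact, h1, SobolevLoops.coeff_ofSmooth]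
        refine (fourierCoeff_loopMatrix_mul (SmoothLoops.continuous_loopMatrix 1)
          (SmoothLoops.continuous_loopMatrix η) (SmoothLoops.summable_norm_fourierCoeff 1)
          (SmoothLoops.summable_norm_fourierCoeff η)).symm.trans ?_
        change fourierCoeff (loopMatrix (1 * η.1)) = fourierCoeff (loopMatrix η.1)
        rw [one_mul]
      mul_smul := fun a b u => by
        refine congrFun ((SobolevLoops.denseRange_ofSmooth s).equalizer (hcont' (a * b))
          ((hcont' a).comp (hcont' b))
          (funext fun η => SobolevLoops.coeff_injective ?_)) u
        change (act (a * b) _).coeff = (act a (act b _)).coeff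
        rw [hact, hact, hact, SobolevLoops.coeff_ofSmooth, (hev a).2, (hev b).2, (hev (a * b)).2,
          map_mul]
        exact conv_conv_fourierCoeff (hev a).1 (hev b).1 (SmoothLoops.continuous_loopMatrix η)
          (hevs a) (hevs b) (SmoothLoops.summable_norm_fourierCoeff η) }
  refine ⟨inst, fun γ η => Subtype.ext (hsmooth γ η), hcont, fun m r hr => ?_⟩
  have hTr : ContDiff ℝ ∞ fun x => (T (r x).1).restrictScalars ℝ :=
    (ContinuousLinearMap.restrictScalarsL ℂ (Sobolev (Matrix (Fin d) (Fin d) ℂ) σ)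
      (Sobolev (Matrix (Fin d) (Fin d) ℂ) σ) ℝ ℝ).contDiff.comp (hTs m _ hr.1)
  exact SobolevLoops.isPlot_of_contDiff
    (((Sobolev.inclusion _ hsσ).restrictScalars ℝ).contDiff.comp (hTr.clm_apply (hΛs m _ hr.2)))

end Action

/-! ### The space `H^{1/2,+}(S^1, G)` -/

namespace SobolevLoopsPlus

variable {d : ℕ} {G : Subgroup (GL (Fin d) ℂ)}

lemma coeff_injective : Function.Injective (coeff (G := G)) := Subtype.val_injective

lemma coeff_incl (k : Set.Ioi (1 / 2 : ℝ)) (a : SobolevLoops G k) :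
    (incl G k a).coeff = a.coeff := rfl

lemma exists_incl_eq (a : SobolevLoopsPlus G) :
    ∃ (k : Set.Ioi (1 / 2 : ℝ)) (b : SobolevLoops G k), incl G k b = a := by
  obtain ⟨c, k, hk, b, hb⟩ := a
  exact ⟨⟨k, hk⟩, b, Subtype.ext hb⟩

lemma continuous_incl (k : Set.Ioi (1 / 2 : ℝ)) : Continuous (incl G k) :=
  continuous_iff_coinduced_le.mpr
    (le_iSup (fun k : Set.Ioi (1 / 2 : ℝ) => TopologicalSpace.coinduced (incl G k) inferInstance) k)

lemma continuous_of_continuous_comp_incl {Y : Type*} [TopologicalSpace Y]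
    {f : SobolevLoopsPlus G → Y} (h : ∀ k, Continuous (f ∘ incl G k)) : Continuous f :=
  continuous_iSup_dom.mpr fun k => continuous_coinduced_dom.mpr (h k)

lemma coeff_ofSmooth (γ : SmoothLoops G) :
    (ofSmooth G γ).coeff = fourierCoeff (loopMatrix γ.1) := rfl

lemma denseRange_ofSmooth : DenseRange (ofSmooth G) := by
  intro a
  obtain ⟨k, b, rfl⟩ := exists_incl_eq a
  refine map_mem_closure (continuous_incl k) (SobolevLoops.denseRange_ofSmooth k b) ?_
  rintro _ ⟨γ, rfl⟩
  refine ⟨γ, coeff_injective ?_⟩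
  rw [coeff_ofSmooth, coeff_incl, SobolevLoops.coeff_ofSmooth]

lemma contDiff_of_contDiff_comp_incl {F : Type*} [NormedAddCommGroup F] [NormedSpace ℝ F]
    {f : SobolevLoopsPlus G → F}
    (h : ∀ (k : Set.Ioi (1 / 2 : ℝ)) (m : ℕ) (q : EuclideanSpace ℝ (Fin m) → SobolevLoops G k),
      Diffeology.IsPlot q → ContDiff ℝ ∞ fun x => f (incl G k (q x)))
    {m : ℕ} {p : EuclideanSpace ℝ (Fin m) → SobolevLoopsPlus G} (hp : Diffeology.IsPlot p) :
    ContDiff ℝ ∞ fun x => f (p x) := by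
  let D : DiffeologicalSpace (SobolevLoopsPlus G) :=
    .ofCorePlotsOn
      { isPlotOn := fun {_ u} _ p => ContDiffOn ℝ ∞ (fun x => f (p x)) u
        isPlotOn_congr := fun _ _ _ h => contDiffOn_congr fun x hx => by rw [h hx]
        isPlot := fun p => ContDiff ℝ ∞ fun x => f (p x)
        isPlotOn_univ := contDiffOn_univ
        isPlot_const := fun _ => contDiff_const
        isPlotOn_reparam := fun _ _ _ h hp hf => hp.comp hf h
        locality := fun _ _ h x hxu => by
          obtain ⟨v, hv, hxv, hv'⟩ := h x hxu
          exact ((hv' x hxv).contDiffAt (hv.mem_nhds hxv)).contDiffWithinAt }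
  -- A plot of the generated diffeology is a plot of every diffeology containing the generators, in
  -- particular of `D`, whose plots are those along which `f` is smooth.
  refine hp D ?_
  rintro ⟨m, p⟩ ⟨k, q, hq, hpq⟩
  change ContDiff ℝ ∞ fun x => f (p x)
  rw [show p = _ from hpq]
  exact h k m q hq

end SobolevLoopsPlus

end

/-! ### Proof of the proposition -/

theorem mainTheorem6 {d : ℕ} (G : Subgroup (GL (Fin d) ℂ))
    (hG_compact : IsCompact (G : Set (GL (Fin d) ℂ)))
    (hG_connected : IsConnected (G : Set (GL (Fin d) ℂ))) :
    (∀ k : ℝ, 1 / 2 < k →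
      ∃ _ : Group (SobolevLoops G k),
        IsPointwiseLoopGroup (G := G) (SobolevLoops.coeff (G := G) (s := k)) ∧
        ∀ s : ℝ, s ≤ k →
          ∃ _ : MulAction (SobolevLoops G k) (SobolevLoops G s),
            IsSmoothExtensionOfLoopMul G (SobolevLoops.ofSmooth G k)
              (SobolevLoops.ofSmooth G s)) ∧
    (∃ _ : Group (SobolevLoopsPlus G),
      IsPointwiseLoopGroup (G := G) (SobolevLoopsPlus.coeff (G := G)) ∧
      ∀ s : ℝ, s ≤ 1 / 2 →
        ∃ _ : MulAction (SobolevLoopsPlus G) (SobolevLoops G s),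
          IsSmoothExtensionOfLoopMul G (SobolevLoopsPlus.ofSmooth G)
            (SobolevLoops.ofSmooth G s)) := by
  -- The cutoff -1/2 is negative, so lifting applies, and it satisfies |σ| ≤ k for all k > 1/2 at
  -- once, so one σ serves the whole union.
  have hσ (s : ℝ) : s = max s (-(1 / 2)) ∨ s < max s (-(1 / 2)) ∧ max s (-(1 / 2)) < 0 := by
    rcases le_or_gt (-(1 / 2)) s with h | h
    · exact .inl (max_eq_left h).symm
    · rw [max_eq_right h.le]
      exact .inr ⟨h, by norm_num⟩
  have hσk {s k : ℝ} (hk : 1 / 2 ≤ k) (hs : s ≤ k) : |max s (-(1 / 2))| ≤ k :=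
    abs_le.mpr ⟨(neg_le_neg hk).trans (le_max_right _ _), max_le hs (by linarith)⟩
  constructor
  · intro k hk
    obtain ⟨hgroup, hX⟩ := exists_isPointwiseLoopGroup SobolevLoops.coeff_injective
      (sobolevLoopSubgroup hG_compact hk) (fun γ hγ => hγ) fun a => by
        obtain ⟨γ, hγ, ha⟩ := a.exists_continuous_loop hG_compact hk
        exact ⟨a.summable_norm_coeff hk, γ, ⟨hγ, a, ha⟩, ha⟩
    refine ⟨hgroup, hX, fun s hs => ?_⟩
    obtain ⟨Λ, hΛ, hΛc, hΛs⟩ := SobolevLoops.exists_lift hG_compact (hσ s)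
    exact exists_isSmoothExtensionOfLoopMul hX (fun a => a.summable_norm_coeff hk)
      (SobolevLoops.coeff_ofSmooth k) (SobolevLoops.denseRange_ofSmooth k) (le_max_left _ _) hΛ hΛc
      hΛs (SobolevLoops.coeff_mulCLM hk (hσk hk.le hs)) (SobolevLoops.continuous_mulCLM hk _)
      fun m p hp => SobolevLoops.contDiff_mulCLM_of_isPlot hk _ hp
  · obtain ⟨hgroup, hX⟩ := exists_isPointwiseLoopGroup SobolevLoopsPlus.coeff_injective
      (sobolevLoopPlusSubgroup hG_compact)
      (fun γ ⟨k, hk, hγ, a, ha⟩ => ⟨hγ, SobolevLoopsPlus.incl G ⟨k, hk⟩ a, ha⟩) fun a => by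
        obtain ⟨⟨k, hk⟩, b, rfl⟩ := a.exists_incl_eq
        obtain ⟨γ, hγ, hb⟩ := b.exists_continuous_loop hG_compact hk
        exact ⟨b.summable_norm_coeff hk, γ, ⟨k, hk, hγ, b, hb⟩, hb⟩
    refine ⟨hgroup, hX, fun s hs => ?_⟩
    obtain ⟨Λ, hΛ, hΛc, hΛs⟩ := SobolevLoops.exists_lift hG_compact (hσ s)
    have hk (k : Set.Ioi (1 / 2 : ℝ)) : |max s (-(1 / 2))| ≤ k :=
      (hσk le_rfl hs).trans (le_of_lt k.2)
    have hlt (k : Set.Ioi (1 / 2 : ℝ)) : 1 / 2 < (k : ℝ) := k.2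
    -- The operator depends only on Fourier coefficients, so the chosen index and representative are
    -- immaterial; `hTi` records this.
    choose κ β hβ using SobolevLoopsPlus.exists_incl_eq (G := G)
    let T (a : SobolevLoopsPlus G) := (β a).mulCLM (hlt (κ a)) (hk (κ a))
    have hT (a u) : (T a u).coeff = conv a.coeff u.coeff := by
      change ((β a).mulCLM (hlt (κ a)) (hk (κ a)) u).coeff = _
      rw [SobolevLoops.coeff_mulCLM, ← SobolevLoopsPlus.coeff_incl, hβ]
    have hTi (k : Set.Ioi (1 / 2 : ℝ)) (b : SobolevLoops G k) :
        T (SobolevLoopsPlus.incl G k b) = b.mulCLM (hlt k) (hk k) := by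
      refine ContinuousLinearMap.ext fun u => Sobolev.ext ?_
      rw [hT, SobolevLoops.coeff_mulCLM, SobolevLoopsPlus.coeff_incl]
    refine exists_isSmoothExtensionOfLoopMul hX (fun a => ?_)
      SobolevLoopsPlus.coeff_ofSmooth SobolevLoopsPlus.denseRange_ofSmooth (le_max_left _ _) hΛ hΛc
      hΛs hT (SobolevLoopsPlus.continuous_of_continuous_comp_incl fun k => ?_) fun m p hp =>
        SobolevLoopsPlus.contDiff_of_contDiff_comp_incl (fun k m q hq => ?_) hp
    · rw [← hβ a, SobolevLoopsPlus.coeff_incl]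
      exact (β a).summable_norm_coeff (hlt (κ a))
    · rw [show T ∘ SobolevLoopsPlus.incl G k = _ from funext (hTi k)]
      exact SobolevLoops.continuous_mulCLM (hlt k) (hk k)
    · simp only [hTi]
      exact SobolevLoops.contDiff_mulCLM_of_isPlot (hlt k) (hk k) hq
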